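/- Let $S^2$ be the unit sphere of $\mathbb R^3$ with geodesic distance $d_{S^2}(x,y)=\arccos\langle x,y\rangle$, and let $T=\{T(x,t):(x,t)\in S^2\times\mathbb R\}$ be a real-valued random field on a probability space, jointly measurable in $(\omega,x,t)$, which is (1) Gaussian, (2) centered, (3) isotropic in space and stationary in time (for all $g\in SO(3)$ and $\tau\in\mathbb R$, the fields $T(x,t)$ and $T(gx,\tau+t)$ have the same finite-dimensional distributions), and (4) mean-square continuous. Write $\mathbb E[T(x,t)T(y,s)]=\Gamma(\langle x,y\rangle,t-s)$, let $P_\ell$ be the Legendre polynomials, and let $$C_\ell(\tau)=2\pi\int_{-1}^1\Gamma(\eta,\tau)P_\ell(\eta)\,d\eta,\qquad \ell=0,1,2,\dots,$$ be the coefficient functions of the expansion $\Gamma(\eta,\tau)=\sum_{\ell\ge 0}\frac{2\ell+1}{4\pi}C_\ell(\tau)P_\ell(\eta)$. Assumption I: there are $0<\beta<2$, $2+\beta<\alpha<4$, $c_0\ge 1$ and $c_1>0$ such that $C_\ell(\tau)=C_\ell(0)(1-|\tau|^\beta)$ for all $\ell\ge 0$ and $|\tau|<1$, $C_0(0)=c_1$,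 and $C_\ell(0)=G(\ell)\,\ell^{-\alpha}$ with $c_0^{-1}\le G(\ell)\le c_0$ for all $\ell\ge 1$. Let $\rho_\alpha(r)=r^{(\alpha-2)/2}$. If $T$ satisfies Assumption I, then there is a constant $C>0$ such that for all integers $n\ge 1$ and all $(x_0,t_0),\dots,(x_n,t_n)\in S^2\times\mathbb R$ with $|t_0-t_k|\le 1$ for $k=1,\dots,n$, almost surely $$\mathrm{Var}\big(T(x_0,t_0)\,\big|\,T(x_1,t_1),\dots,T(x_n,t_n)\big)\ \ge\ C\min_{1\le k\le n}\rho_\alpha\big(d_{S^2}(x_0,x_k)\big)^2 .$$ -/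

import Mathlib

open MeasureTheory ProbabilityTheory Filter Topology

noncomputable section

namespace SphereTime

/-- The ambient Euclidean space `ℝ³`. -/
abbrev E3 : Type := EuclideanSpace ℝ (Fin 3)

/-- The unit sphere `S²` of `ℝ³`. -/
abbrev S2 : Type := Metric.sphere (0 : E3) 1

/-- The geodesic (great circle) distance on `S²`. -/
def dS2 (x y : S2) : ℝ := InnerProductGeometry.angle (x : E3) (y : E3)

/-- The action of a linear isometry of `ℝ³` on `S²`. -/
def rot (g : E3 ≃ₗᵢ[ℝ] E3) (x : S2) : S2 :=
  ⟨g x, by simp⟩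

/-- A space-time real-valued spherical random field (jointly measurable in the sample point and in
space-time) that is Gaussian, centered, isotropic in space and stationary in time, and mean-square
continuous. The elements of `SO(3)` are the linear isometries of `ℝ³` of determinant one, and
invariance is equality of the finite-dimensional distributions. -/
structure IsSpaceTimeField {Ω : Type*} [MeasurableSpace Ω] (μ : Measure Ω)
    (T : S2 × ℝ → Ω → ℝ) : Prop where
  measurable : Measurable (fun q : (S2 × ℝ) × Ω => T q.1 q.2)
  gaussian : IsGaussianProcess T μ
  centered : ∀ p, ∫ ω, T p ω ∂μ = 0
  invariant : ∀ g : E3 ≃ₗᵢ[ℝ] E3, LinearMap.det (g.toLinearEquiv : E3 →ₗ[ℝ] E3) = 1 →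
    ∀ (τ : ℝ) (n : ℕ) (p : Fin n → S2 × ℝ),
      IdentDistrib (fun ω k => T (rot g (p k).1, τ + (p k).2) ω) (fun ω k => T (p k) ω) μ μ
  continuous : ∀ p, Tendsto (fun q => ∫ ω, (T q ω - T p ω) ^ 2 ∂μ) (𝓝 p) (𝓝 0)

/-- The Legendre polynomial of degree `l`, by Rodrigues' formula. -/
def legendreP (l : ℕ) : Polynomial ℝ :=
  Polynomial.C (1 / (2 ^ l * (l.factorial : ℝ))) *
    Polynomial.derivative^[l] ((Polynomial.X ^ 2 - 1) ^ l)

/-- The point `(sin θ, 0, cos θ)` of `S²`; it is the north pole for `θ = 0`. -/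
def meridian (θ : ℝ) : S2 :=
  ⟨!₂[Real.sin θ, 0, Real.cos θ], by
    simp [EuclideanSpace.norm_eq, Fin.sum_univ_three]⟩

/-- The covariance function `Γ(η, τ)`, `η ∈ [-1, 1]`, `τ ∈ ℝ`, for which
`E[T(x,t) T(y,s)] = Γ(⟪x, y⟫, t - s)` when `T` is isotropic and stationary. It is read off at the
north pole and at the point of a fixed meridian whose inner product with the north pole is `η`. -/
def covFun {Ω : Type*} [MeasurableSpace Ω] (μ : Measure Ω) (T : S2 × ℝ → Ω → ℝ)
    (η τ : ℝ) : ℝ :=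
  ∫ ω, T (meridian 0, τ) ω * T (meridian (Real.arccos η), 0) ω ∂μ

/-- The angular power spectrum `C_l(τ)`: the coefficient functions of the expansion
`Γ(η, τ) = ∑ l, (2 l + 1) / (4 π) * C_l(τ) * P_l(η)`. As `∫_{-1}^{1} P_l P_m = 2 δ_{l m} / (2 l + 1)`,
they are `C_l(τ) = 2 π ∫_{-1}^{1} Γ(η, τ) P_l(η) dη`. -/
def powerSpectrum {Ω : Type*} [MeasurableSpace Ω] (μ : Measure Ω) (T : S2 × ℝ → Ω → ℝ)
    (l : ℕ) (τ : ℝ) : ℝ :=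
  2 * Real.pi * ∫ η in (-1 : ℝ)..1, covFun μ T η τ * (legendreP l).eval η

/-- Assumption I, with parameters `α` and `β`, on a family of functions `C_l`. -/
structure AssumptionI (α β : ℝ) (C : ℕ → ℝ → ℝ) : Prop where
  beta_pos : 0 < β
  beta_lt : β < 2
  lt_alpha : 2 + β < α
  alpha_lt : α < 4
  time : ∀ (l : ℕ) (τ : ℝ), |τ| < 1 → C l τ = C l 0 * (1 - |τ| ^ β)
  zero_pos : 0 < C 0 0
  decay : ∃ (G : ℕ → ℝ) (c₀ : ℝ), 1 ≤ c₀ ∧ ∀ l : ℕ, 1 ≤ l →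
    C l 0 = G l * (l : ℝ) ^ (-α) ∧ c₀⁻¹ ≤ G l ∧ G l ≤ c₀

/-- The function `ρ_α(r) = r ^ ((α - 2) / 2)`. -/
def rho (α r : ℝ) : ℝ := r ^ ((α - 2) / 2)

/-- The sigma-algebra generated by the values of the field at the points `p k`. -/
abbrev sigmaAt {Ω : Type*} (T : S2 × ℝ → Ω → ℝ) {n : ℕ} (p : Fin n → S2 × ℝ) :
    MeasurableSpace Ω :=
  ⨆ k, MeasurableSpace.comap (T (p k)) inferInstance

end SphereTime

end

/-! The conditional variance of a Gaussian field is the squared L² distance from `T p₀` to its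
projection on the conditioning values (`exists_condVar_eq`). A lower bound follows by duality: if W
pairs to 1 with `T p₀` and to 0 with every conditioning value, Cauchy–Schwarz bounds that squared
distance below by ‖W‖⁻².

W is built from the field at the single time t₀. Integrating it against the zonal harmonic of degree
l about x₀ gives V_l, and Funk–Hecke yields ⟨T(y,s), V_l⟩ = C_l(t₀-s) P_l(⟨x₀,y⟩); the V_l are
orthogonal with ‖V_l‖² = 4π C_l(0)/(2l+1). Since C_l(τ) = C_l(0) h(τ) with one h for all l, W = ∑
(c_l/C_l(0)) V_l pairs with T(y,s) to h(t₀-s) u(⟨x₀,y⟩), where u = ∑ c_l P_l. Let u be a bump with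
u(1) = 1 that vanishes on η ≤ 1-δ, where δ = 1 - cos r and r is the distance from x₀ to the nearest
conditioning site. Every conditioning site then lies where u vanishes, whatever its time. Partial
sums of W suffice, so no convergence in L² is needed (`one_le_mul_norm_sub_sum_sq_of_lt`).

For the norm, C_l(0)⁻¹ ≲ δ^(-α/2) (1 + δ² l²(l+1)²) because α < 4 (`exists_inv_le`), and Bessel's
inequality for u and for its image under the Legendre operator bounds the weighted energy by 325 δ
(`exists_bump`). Hence the variance is ≳ δ^((α-2)/2), which is comparable to r^(α-2) = ρ_α(r)². -/

namespace SphereTime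

/-! ### Legendre polynomials: differential equation, endpoint values, degrees. -/

-- Leibniz's rule stops after three terms because X² has only two nonzero derivatives. Taking n + 1
-- derivatives of p' keeps all orders on p free of subtraction.
open Polynomial in
theorem iterate_derivative_derivative_mul_X_sq_succ (p : ℝ[X]) (n : ℕ) :
    derivative^[n + 1] (derivative p * X ^ 2) = derivative^[n + 2] p * X ^ 2
      + C (2 * ((n : ℝ) + 1)) * (derivative^[n + 1] p * X)
      + C (((n : ℝ) + 1) * n) * derivative^[n] p := by
  induction n with
  | zero => simp [derivative_mul, derivative_pow]; ring
  | succ n ih =>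
    rw [Function.iterate_succ_apply', ih]
    simp only [derivative_mul, derivative_pow, derivative_C, derivative_X,
      ← Function.iterate_succ_apply' derivative, Nat.cast_add, Nat.cast_one, map_add, map_mul,
      Nat.cast_ofNat, map_one]
    simp only [map_ofNat, Nat.reduceSub, pow_one, Nat.succ_eq_add_one, map_natCast, mul_one,
      derivative_one]
    ring

/-- The Legendre differential operator `p ↦ ((1 - X²) p')'`. -/
noncomputable def legendreOp (p : Polynomial ℝ) : Polynomial ℝ :=
  Polynomial.derivative ((1 - Polynomial.X ^ 2) * Polynomial.derivative p)

open Polynomial in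
theorem legendreOp_eval (p : ℝ[X]) (x : ℝ) : (legendreOp p).eval x =
    (1 - x ^ 2) * (derivative (derivative p)).eval x - 2 * x * (derivative p).eval x := by
  simp [legendreOp, derivative_mul]; ring

-- The power v = (X² - 1)^l satisfies (X² - 1) v' = 2l X v. Differentiating this l + 1 times gives
-- Legendre's equation for the l-th derivative of v.
open Polynomial in
theorem legendreOp_legendreP (l : ℕ) :
    legendreOp (legendreP l) = C (-((l : ℝ) * (l + 1))) * legendreP l := by
  set v : ℝ[X] := (X ^ 2 - 1) ^ l with hv
  have h1 : derivative v * X ^ 2 - derivative v = C (2 * (l : ℝ)) * (v * X) := by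
    rcases l with _ | l
    · simp [hv]
    · simp only [hv, derivative_pow, derivative_sub, derivative_X, derivative_one]
      simp
      ring
  have h2 := congrArg (derivative^[l + 1]) h1
  rw [iterate_derivative_sub, iterate_derivative_derivative_mul_X_sq_succ,
    iterate_derivative_C_mul, iterate_derivative_mul_X] at h2
  simp only [← Function.iterate_succ_apply, Nat.succ_eq_add_one, add_tsub_cancel_right] at h2
  have h3 : legendreOp (derivative^[l] v) = C (-((l : ℝ) * (l + 1))) * derivative^[l] v := by
    simp only [legendreOp, derivative_mul, derivative_sub, derivative_pow, derivative_X,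
      derivative_one, ← Function.iterate_succ_apply' derivative, Nat.succ_eq_add_one]
    simp only [map_add, map_mul, map_neg, map_natCast, map_one, nsmul_eq_mul, map_ofNat,
      Nat.cast_add, Nat.cast_one, Nat.cast_ofNat, Nat.reduceSub, pow_one, mul_one] at h2 ⊢
    linear_combination -h2
  have h4 : ∀ (c : ℝ) (q : ℝ[X]), legendreOp (C c * q) = C c * legendreOp q := by
    intro c q
    simp [legendreOp, derivative_mul]; ring
  rw [legendreP, h4, h3]; ring

-- When a² = 1, shifting X² - 1 by a gives X (X + 2a), so the l-th Taylor coefficient at a of its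
-- l-th power is (2a)^l.
open Polynomial in
theorem legendreP_eval_of_sq_eq_one (l : ℕ) {a : ℝ} (ha : a ^ 2 = 1) :
    (legendreP l).eval a = a ^ l := by
  have h1 : (derivative^[l] ((X ^ 2 - 1 : ℝ[X]) ^ l)).eval a
      = l.factorial * (2 * a) ^ l := by
    have := congrArg (fun f => f ((X ^ 2 - 1 : ℝ[X]) ^ l)) (factorial_smul_hasseDeriv (R := ℝ) l)
    simp only [LinearMap.smul_apply] at this
    rw [← this]
    simp only [nsmul_eq_mul, eval_mul, eval_natCast]
    rw [← taylor_coeff]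
    have h2 : taylor a ((X ^ 2 - 1 : ℝ[X]) ^ l) = (X + C (2 * a)) ^ l * X ^ l := by
      rw [← mul_pow]
      simp only [taylor_apply, pow_comp, sub_comp, X_comp, one_comp]
      congr 1
      have : (C a : ℝ[X]) ^ 2 = 1 := by rw [← C_pow, ha, C_1]
      simp only [map_mul, map_ofNat]
      linear_combination this
    rw [h2]
    have := coeff_mul_X_pow ((X + C (2 * a)) ^ l) l 0
    rw [zero_add] at this
    rw [this, coeff_zero_eq_eval_zero]
    simp
  rw [legendreP, eval_mul, eval_C, h1, mul_pow]
  have : (l.factorial : ℝ) ≠ 0 := by positivity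
  field_simp

open Polynomial in
theorem natDegree_legendreP_le (l : ℕ) : (legendreP l).natDegree ≤ l := by
  refine (natDegree_C_mul_le _ _).trans ((natDegree_iterate_derivative _ _).trans ?_)
  have : ((X ^ 2 - 1 : ℝ[X]) ^ l).natDegree ≤ l * 2 :=
    natDegree_pow_le_of_le _ (by compute_degree)
  omega

open Polynomial in
theorem coeff_legendreP_pos (l : ℕ) : 0 < (legendreP l).coeff l := by
  rw [legendreP, coeff_C_mul, coeff_iterate_derivative]
  have h : ((X ^ 2 - 1 : ℝ[X]) ^ l).coeff (l + l) = 1 := by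
    have hm : ((X ^ 2 - 1 : ℝ[X])).Monic := monic_X_pow_sub_C (1 : ℝ) two_ne_zero
    have hd : ((X ^ 2 - 1 : ℝ[X]) ^ l).natDegree = l + l := by
      rw [hm.natDegree_pow]
      have : (X ^ 2 - 1 : ℝ[X]).natDegree = 2 := natDegree_X_pow_sub_C (r := (1 : ℝ))
      rw [this]; ring
    rw [← hd]
    exact (hm.pow l)
  rw [h]
  have : 0 < (l + l).descFactorial l := Nat.descFactorial_pos.2 (by omega)
  rw [nsmul_eq_mul, mul_one]
  positivity

open Polynomial in
theorem mem_span_legendreP (n : ℕ) : ∀ p : ℝ[X], p.degree < n →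
    p ∈ Submodule.span ℝ (legendreP '' Set.Iio n) := by
  induction n with
  | zero => intro p hp; simp_all
  | succ n ih =>
    intro p hp
    set c := p.coeff n / (legendreP n).coeff n with hc
    have h1 : (p - c • legendreP n).degree < n := by
      rw [degree_lt_iff_coeff_zero]
      intro m hm
      rcases hm.eq_or_lt with rfl | hm
      · simp [hc, (coeff_legendreP_pos n).ne']
      · rw [coeff_sub, coeff_smul,
          coeff_eq_zero_of_natDegree_lt ((natDegree_legendreP_le n).trans_lt hm),
          coeff_eq_zero_of_degree_lt (hp.trans_le (by exact_mod_cast hm))]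
        simp
    have h2 : p = (p - c • legendreP n) + c • legendreP n := by ring
    rw [h2]
    refine Submodule.add_mem _ (Submodule.span_mono ?_ (ih _ h1))
      (Submodule.smul_mem _ _ (Submodule.subset_span ⟨n, by simp, rfl⟩))
    exact Set.image_mono (Set.Iio_subset_Iio (Nat.le_succ n))

/-! ### Orthogonality, completeness and Legendre series. -/

open Polynomial in
/-- The Legendre operator is symmetric on `[-1, 1]`. -/
theorem integral_legendreOp_mul (p : ℝ[X]) {u u' u'' : ℝ → ℝ}
    (h1 : ∀ x, HasDerivAt u (u' x) x) (h2 : ∀ x, HasDerivAt u' (u'' x) x)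
    (hc : Continuous u'') :
    ∫ x in (-1 : ℝ)..1, (legendreOp p).eval x * u x =
      ∫ x in (-1 : ℝ)..1, p.eval x * ((1 - x ^ 2) * u'' x - 2 * x * u' x) := by
  have cu : Continuous u := continuous_iff_continuousAt.2 fun x => (h1 x).continuousAt
  have cu' : Continuous u' := continuous_iff_continuousAt.2 fun x => (h2 x).continuousAt
  rw [← sub_eq_zero, ← intervalIntegral.integral_sub]
  rotate_left
  · exact (by fun_prop : Continuous _).intervalIntegrable _ _
  · exact (by fun_prop : Continuous _).intervalIntegrable _ _
  -- Lagrange's identity: the difference of integrands is exact, and the factor 1 - x² kills both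
  -- boundary terms.
  rw [intervalIntegral.integral_eq_sub_of_hasDerivAt
    (f := fun x => (1 - x ^ 2) * ((derivative p).eval x * u x - p.eval x * u' x))]
  · norm_num
  · intro x _
    have e1 : HasDerivAt (fun x : ℝ => 1 - x ^ 2) (-(2 * x)) x := by
      simpa using ((hasDerivAt_id x).pow 2).const_sub 1
    refine (e1.mul ((((derivative p).hasDerivAt x).mul (h1 x)).sub
      ((p.hasDerivAt x).mul (h2 x)))).congr_deriv ?_
    rw [legendreOp_eval]
    simp only [Pi.sub_apply, Pi.mul_apply]
    ring
  · exact (by fun_prop : Continuous _).intervalIntegrable _ _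

open Polynomial in
theorem integral_legendreP_mul_legendreP {k l : ℕ} (h : k ≠ l) :
    ∫ x in (-1 : ℝ)..1, (legendreP k).eval x * (legendreP l).eval x = 0 := by
  have := integral_legendreOp_mul (legendreP k) (fun x => (legendreP l).hasDerivAt x)
    (fun x => (derivative (legendreP l)).hasDerivAt x) (by fun_prop)
  simp only [← legendreOp_eval, legendreOp_legendreP, eval_mul, eval_C] at this
  simp only [mul_assoc, mul_left_comm _ (-((l : ℝ) * (l + 1))),
    intervalIntegral.integral_const_mul] at this
  have hne : (k : ℝ) * (k + 1) ≠ l * (l + 1) := by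
    norm_cast
    rcases h.lt_or_gt with h | h
    · exact (by nlinarith : k * (k + 1) < l * (l + 1)).ne
    · exact (by nlinarith : l * (l + 1) < k * (k + 1)).ne'
  have h3 : ((k : ℝ) * (k + 1) - l * (l + 1)) *
      ∫ x in (-1 : ℝ)..1, (legendreP k).eval x * (legendreP l).eval x = 0 := by
    linear_combination -this
  exact (mul_eq_zero.1 h3).resolve_left (sub_ne_zero.2 hne)

open Polynomial in
theorem integral_mul_eval_eq_zero {g : ℝ → ℝ} (hg : ContinuousOn g (Set.Icc (-1) 1)) (n : ℕ)
    (h : ∀ l < n, ∫ x in (-1 : ℝ)..1, g x * (legendreP l).eval x = 0) (p : ℝ[X])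
    (hp : p.degree < n) : ∫ x in (-1 : ℝ)..1, g x * p.eval x = 0 := by
  have hi : ∀ q : ℝ[X], IntervalIntegrable (fun x => g x * q.eval x) volume (-1) 1 := fun q =>
    ContinuousOn.intervalIntegrable (by
      rw [Set.uIcc_of_le (by norm_num)]; exact hg.mul q.continuous.continuousOn)
  have hm := mem_span_legendreP n p hp
  clear hp
  induction hm using Submodule.span_induction with
  | mem x hx => obtain ⟨k, hk, rfl⟩ := hx; exact h k hk
  | zero => simp
  | add q r _ _ hq hr =>
    simp only [eval_add, mul_add]
    rw [intervalIntegral.integral_add (hi q) (hi r), hq, hr, add_zero]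
  | smul c q _ hq =>
    simp only [eval_smul, smul_eq_mul, mul_left_comm _ c]
    rw [intervalIntegral.integral_const_mul, hq, mul_zero]

-- The polynomial X P' - l P has degree below l, hence is orthogonal to P, so ∫ x P P' = l ∫ P².
-- Integrating (x P²)' = P² + 2 x P P' gives 2, which determines ∫ P².
open Polynomial in
theorem integral_legendreP_sq (l : ℕ) :
    ∫ x in (-1 : ℝ)..1, (legendreP l).eval x * (legendreP l).eval x = 2 / (2 * l + 1) := by
  set P := legendreP l with hP
  have hd : (X * derivative P - C (l : ℝ) * P).degree < (l : WithBot ℕ) := by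
    rw [degree_lt_iff_coeff_zero]
    intro m hm
    have h0 : ∀ m : ℕ, (X * derivative P - C (l : ℝ) * P).coeff m = ((m : ℝ) - l) * P.coeff m := by
      intro m
      rcases m with _ | m
      · simp
      · simp [coeff_X_mul, coeff_derivative]; ring
    rw [h0]
    rcases hm.eq_or_lt with rfl | hm
    · simp
    · rw [coeff_eq_zero_of_natDegree_lt ((natDegree_legendreP_le l).trans_lt hm), mul_zero]
  have h1 := integral_mul_eval_eq_zero (g := fun x => P.eval x) P.continuous.continuousOn l
    (fun k hk => integral_legendreP_mul_legendreP hk.ne') _ hd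
  have h2 : ∫ x in (-1 : ℝ)..1, ((P.eval x * P.eval x)
      + 2 * (P.eval x * (x * (derivative P).eval x))) = 2 := by
    rw [intervalIntegral.integral_eq_sub_of_hasDerivAt (f := fun x => x * (P.eval x * P.eval x))]
    · rw [hP, legendreP_eval_of_sq_eq_one l (by norm_num : (1 : ℝ) ^ 2 = 1),
        legendreP_eval_of_sq_eq_one l (by norm_num : (-1 : ℝ) ^ 2 = 1), ← mul_pow (-1 : ℝ)]
      norm_num
    · intro x _
      refine ((hasDerivAt_id x).mul ((P.hasDerivAt x).mul (P.hasDerivAt x))).congr_deriv ?_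
      simp only [id, Pi.mul_apply]
      ring
    · exact (by fun_prop : Continuous _).intervalIntegrable _ _
  have h3 : ∫ x in (-1 : ℝ)..1, ((P.eval x * P.eval x)
      + 2 * (P.eval x * (x * (derivative P).eval x)))
      = ∫ x in (-1 : ℝ)..1, ((2 * l + 1) * (P.eval x * P.eval x)
        + 2 * (P.eval x * (X * derivative P - C (l : ℝ) * P).eval x)) := by
    congr 1; ext x; simp; ring
  rw [h3, intervalIntegral.integral_add, intervalIntegral.integral_const_mul,
    intervalIntegral.integral_const_mul, h1] at h2
  · have : (2 * (l : ℝ) + 1) ≠ 0 := by positivity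
    rw [eq_div_iff this]
    linarith
  · exact (by fun_prop : Continuous _).intervalIntegrable _ _
  · exact (by fun_prop : Continuous _).intervalIntegrable _ _

/-- Such a g is orthogonal to all polynomials. By Weierstrass approximation it is then orthogonal to
itself. -/
theorem eq_zero_of_integral_mul_legendreP_eq_zero {g : ℝ → ℝ}
    (hg : ContinuousOn g (Set.Icc (-1) 1))
    (h : ∀ l, ∫ x in (-1 : ℝ)..1, g x * (legendreP l).eval x = 0) :
    ∀ x ∈ Set.Icc (-1 : ℝ) 1, g x = 0 := by
  have h0 : ∀ p : Polynomial ℝ, ∫ x in (-1 : ℝ)..1, g x * p.eval x = 0 := fun p =>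
    integral_mul_eval_eq_zero hg (p.natDegree + 1) (fun l _ => h l) p
      (Polynomial.degree_le_natDegree.trans_lt (by exact_mod_cast Nat.lt_succ_self _))
  have hu : Set.uIcc (-1 : ℝ) 1 = Set.Icc (-1) 1 := Set.uIcc_of_le (by norm_num)
  have hsq : IntervalIntegrable (fun x => g x * g x) volume (-1) 1 :=
    ContinuousOn.intervalIntegrable (by rw [hu]; exact hg.mul hg)
  obtain ⟨M, hM⟩ := isCompact_Icc.exists_bound_of_continuousOn hg
  have hM0 : 0 ≤ M := (norm_nonneg _).trans (hM 0 (by norm_num))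
  have h1 : ∫ x in (-1 : ℝ)..1, g x * g x = 0 := by
    refine le_antisymm (le_of_forall_pos_le_add fun ε hε => ?_)
      (intervalIntegral.integral_nonneg (by norm_num) fun x _ => mul_self_nonneg _)
    obtain ⟨p, hp⟩ := exists_polynomial_near_of_continuousOn (-1) 1 g hg (ε / (2 * (M + 1)))
      (by positivity)
    have hip : IntervalIntegrable (fun x => g x * p.eval x) volume (-1) 1 :=
      ContinuousOn.intervalIntegrable (by rw [hu]; exact hg.mul p.continuous.continuousOn)
    have h2 : ∫ x in (-1 : ℝ)..1, g x * g x = ∫ x in (-1 : ℝ)..1, (g x * g x - g x * p.eval x) := by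
      rw [intervalIntegral.integral_sub hsq hip, h0, sub_zero]
    have h3 := intervalIntegral.norm_integral_le_of_norm_le_const (a := -1) (b := 1)
      (C := M * (ε / (2 * (M + 1)))) (f := fun x => g x * g x - g x * p.eval x) (by
        intro x hx
        rw [Set.uIoc_of_le (by norm_num)] at hx
        have hx' : x ∈ Set.Icc (-1 : ℝ) 1 := Set.Ioc_subset_Icc_self hx
        rw [← mul_sub, norm_mul, Real.norm_eq_abs (g x - _), abs_sub_comm]
        exact mul_le_mul (hM x hx') (hp x hx').le (abs_nonneg _) hM0)
    rw [h2, zero_add]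
    refine (le_abs_self _).trans (h3.trans ?_)
    rw [show |(1 : ℝ) - -1| = 2 by norm_num]
    have : M * (ε / (2 * (M + 1))) * 2 = ε * (M / (M + 1)) := by field_simp
    rw [this]
    exact mul_le_of_le_one_right hε.le ((div_le_one (by positivity)).2 (by linarith))
  intro x hx
  by_contra hne
  have := intervalIntegral.integral_pos (a := (-1 : ℝ)) (b := 1) (by norm_num) (hg.mul hg)
    (fun x _ => mul_self_nonneg _) ⟨x, hx, mul_self_pos.2 hne⟩
  simp only [Pi.mul_apply] at this
  linarith

/-- A continuous function with absolutely convergent Legendre series is its sum. -/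
theorem hasSum_legendre {g : ℝ → ℝ} (hg : ContinuousOn g (Set.Icc (-1) 1))
    (hP : ∀ l, ∀ x ∈ Set.Icc (-1 : ℝ) 1, |(legendreP l).eval x| ≤ 1)
    (hs : Summable fun l : ℕ => |(2 * (l : ℝ) + 1) / 2 *
      ∫ y in (-1 : ℝ)..1, g y * (legendreP l).eval y|) :
    ∀ x ∈ Set.Icc (-1 : ℝ) 1, HasSum (fun l : ℕ => ((2 * (l : ℝ) + 1) / 2 *
      ∫ y in (-1 : ℝ)..1, g y * (legendreP l).eval y) * (legendreP l).eval x) (g x) := by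
  set c : ℕ → ℝ := fun l => (2 * (l : ℝ) + 1) / 2 *
      ∫ y in (-1 : ℝ)..1, g y * (legendreP l).eval y with hc
  have hb : ∀ l, ∀ x ∈ Set.Icc (-1 : ℝ) 1, ‖c l * (legendreP l).eval x‖ ≤ |c l| := by
    intro l x hx
    rw [norm_mul, Real.norm_eq_abs]
    exact mul_le_of_le_one_right (abs_nonneg _) (hP l x hx)
  have hsum : ∀ x ∈ Set.Icc (-1 : ℝ) 1, Summable fun l => c l * (legendreP l).eval x :=
    fun x hx => Summable.of_norm_bounded hs fun l => hb l x hx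
  have hu : Set.uIcc (-1 : ℝ) 1 = Set.Icc (-1) 1 := Set.uIcc_of_le (by norm_num)
  set S : ℝ → ℝ := fun x => ∑' l, c l * (legendreP l).eval x with hS
  have hSc : ContinuousOn S (Set.Icc (-1) 1) :=
    continuousOn_tsum (fun l => by fun_prop) hs hb
  have hco : ∀ k, ∫ x in (-1 : ℝ)..1, S x * (legendreP k).eval x =
      ∫ x in (-1 : ℝ)..1, g x * (legendreP k).eval x := by
    intro k
    have := intervalIntegral.hasSum_integral_of_dominated_convergence (μ := volume)
      (a := -1) (b := 1)
      (F := fun l x => c l * (legendreP l).eval x * (legendreP k).eval x)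
      (f := fun x => S x * (legendreP k).eval x) (fun l _ => |c l|)
      (fun l => (by fun_prop : Continuous _).aestronglyMeasurable)
      (fun l => ae_of_all _ fun x hx => by
        rw [Set.uIoc_of_le (by norm_num)] at hx
        have hx' := Set.Ioc_subset_Icc_self hx
        rw [norm_mul]
        exact (mul_le_of_le_one_right (norm_nonneg _) (hP k x hx')).trans (hb l x hx'))
      (ae_of_all _ fun x _ => hs) (by simp) (ae_of_all _ fun x hx => by
        rw [Set.uIoc_of_le (by norm_num)] at hx
        exact (hsum x (Set.Ioc_subset_Icc_self hx)).hasSum.mul_right _)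
    have h2 := this.unique (hasSum_single k fun l hl => by
      simp only [mul_assoc, intervalIntegral.integral_const_mul,
        integral_legendreP_mul_legendreP hl, mul_zero])
    rw [h2]
    simp only [mul_assoc, intervalIntegral.integral_const_mul, integral_legendreP_sq, hc]
    have : (2 * (k : ℝ) + 1) ≠ 0 := by positivity
    field_simp
  intro x hx
  have h := eq_zero_of_integral_mul_legendreP_eq_zero (hSc.sub hg) (fun l => by
    simp only [Pi.sub_apply, sub_mul]
    rw [intervalIntegral.integral_sub, hco, sub_self]
    · exact ContinuousOn.intervalIntegrable (by rw [hu]; exact hSc.mul (by fun_prop))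
    · exact ContinuousOn.intervalIntegrable (by rw [hu]; exact hg.mul (by fun_prop))) x hx
  have h' : S x = g x := sub_eq_zero.1 h
  exact h' ▸ (hsum x hx).hasSum

/-- Bessel's inequality for Legendre polynomials. -/
theorem sum_sq_integral_mul_legendreP_le {g : ℝ → ℝ} (hg : Continuous g) (s : Finset ℕ) :
    ∑ l ∈ s, (2 * (l : ℝ) + 1) / 2 * (∫ y in (-1 : ℝ)..1, g y * (legendreP l).eval y) ^ 2 ≤
      ∫ y in (-1 : ℝ)..1, g y ^ 2 := by
  set I : ℕ → ℝ := fun l => ∫ y in (-1 : ℝ)..1, g y * (legendreP l).eval y with hI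
  set c : ℕ → ℝ := fun l => (2 * (l : ℝ) + 1) / 2 * I l with hc
  set S : ℝ → ℝ := fun y => ∑ l ∈ s, c l * (legendreP l).eval y with hS
  have hSc : Continuous S := by fun_prop
  have ii : ∀ {f : ℝ → ℝ}, Continuous f → IntervalIntegrable f volume (-1) 1 :=
    fun hf => hf.intervalIntegrable _ _
  have h1 : ∀ f : ℝ → ℝ, Continuous f → ∫ y in (-1 : ℝ)..1, f y * S y =
      ∑ l ∈ s, c l * ∫ y in (-1 : ℝ)..1, f y * (legendreP l).eval y := by
    intro f hf
    simp only [hS, Finset.mul_sum, mul_left_comm _ (c _)]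
    rw [intervalIntegral.integral_finsetSum fun l _ => ii (by fun_prop)]
    simp only [intervalIntegral.integral_const_mul]
  have h2 : ∀ l ∈ s, ∫ y in (-1 : ℝ)..1, S y * (legendreP l).eval y = I l := by
    intro l hl
    simp only [mul_comm (S _)]
    rw [h1 _ (by fun_prop), Finset.sum_eq_single l]
    · rw [integral_legendreP_sq]
      have : (2 * (l : ℝ) + 1) ≠ 0 := by positivity
      simp only [hc]; field_simp
    · intro k _ hk
      rw [integral_legendreP_mul_legendreP hk.symm, mul_zero]
    · exact fun h => absurd hl h
  have h3 : 0 ≤ ∫ y in (-1 : ℝ)..1, (g y - S y) ^ 2 :=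
    intervalIntegral.integral_nonneg (by norm_num) fun _ _ => sq_nonneg _
  have h4 : ∫ y in (-1 : ℝ)..1, (g y - S y) ^ 2 = (∫ y in (-1 : ℝ)..1, g y ^ 2)
      - 2 * (∫ y in (-1 : ℝ)..1, g y * S y) + ∫ y in (-1 : ℝ)..1, S y * S y := by
    rw [← intervalIntegral.integral_const_mul, ← intervalIntegral.integral_sub (ii (by fun_prop))
      (ii (by fun_prop)), ← intervalIntegral.integral_add (ii (by fun_prop)) (ii (by fun_prop))]
    congr 1; ext y; ring
  have h6 : ∑ l ∈ s, c l * ∫ y in (-1 : ℝ)..1, S y * (legendreP l).eval y = ∑ l ∈ s, c l * I l :=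
    Finset.sum_congr rfl fun l hl => by rw [h2 l hl]
  rw [h4, h1 g hg, h1 S hSc, h6] at h3
  have h5 : ∑ l ∈ s, (2 * (l : ℝ) + 1) / 2 * I l ^ 2 = ∑ l ∈ s, c l * I l :=
    Finset.sum_congr rfl fun l _ => by simp only [hc]; ring
  rw [h5]
  linarith

/-! ### Circle averages, the product formula and Funk–Hecke. -/

theorem hasDerivAt_intervalIntegral_of_continuous {G G' : ℝ → ℝ → ℝ} (hG : Continuous fun x : ℝ × ℝ => G x.1 x.2)
    (hG' : Continuous fun x : ℝ × ℝ => G' x.1 x.2) (h : ∀ a φ, HasDerivAt (fun a => G a φ) (G' a φ) a)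
    (s t a : ℝ) :
    HasDerivAt (fun a => ∫ φ in s..t, G a φ) (∫ φ in s..t, G' a φ) a := by
  obtain ⟨M, hM⟩ := ((isCompact_Icc (a := a - 1) (b := a + 1)).prod
    (isCompact_uIcc (a := s) (b := t))).exists_bound_of_continuousOn hG'.continuousOn
  refine (intervalIntegral.hasDerivAt_integral_of_dominated_loc_of_deriv_le
    (bound := fun _ => M) (s := Set.Icc (a - 1) (a + 1)) (Icc_mem_nhds (by linarith) (by linarith))
    (Eventually.of_forall fun x => ?_) ?_ ?_ ?_ (by simp) ?_).2
  · exact (hG.comp (by fun_prop : Continuous fun φ => (x, φ))).aestronglyMeasurable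
  · exact (hG.comp (by fun_prop : Continuous fun φ => (a, φ))).intervalIntegrable _ _
  · exact (hG'.comp (by fun_prop : Continuous fun φ => (a, φ))).aestronglyMeasurable
  · exact ae_of_all _ fun φ hφ x hx => hM (x, φ) ⟨hx, Set.uIoc_subset_uIcc hφ⟩
  · exact ae_of_all _ fun φ _ x _ => h x φ

/-- The inner product of the unit vectors with polar coordinates `(a, φ)` and with Cartesian
coordinates `(p, q, c)`. -/
noncomputable def zcoord (c p q a φ : ℝ) : ℝ :=
  c * Real.cos a + Real.sin a * (p * Real.cos φ + q * Real.sin φ)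

theorem continuous_zcoord (c p q : ℝ) : Continuous fun x : ℝ × ℝ => zcoord c p q x.1 x.2 := by
  unfold zcoord; fun_prop

theorem zcoord_mem {c p q : ℝ} (h : c ^ 2 + p ^ 2 + q ^ 2 = 1) (a φ : ℝ) :
    zcoord c p q a φ ∈ Set.Icc (-1 : ℝ) 1 := by
  rw [Set.mem_Icc, ← abs_le, ← sq_le_one_iff_abs_le_one, zcoord]
  have h1 := Real.sin_sq_add_cos_sq a
  have h2 := Real.sin_sq_add_cos_sq φ
  set w := p * Real.cos φ + q * Real.sin φ with hw
  have h3 : w ^ 2 + (p * Real.sin φ - q * Real.cos φ) ^ 2 = p ^ 2 + q ^ 2 := by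
    rw [hw]; linear_combination (p ^ 2 + q ^ 2) * h2
  have h4 : (c * Real.cos a + Real.sin a * w) ^ 2 + (c * Real.sin a - Real.cos a * w) ^ 2
      = c ^ 2 + w ^ 2 := by linear_combination (c ^ 2 + w ^ 2) * h1
  nlinarith [sq_nonneg (p * Real.sin φ - q * Real.cos φ),
    sq_nonneg (c * Real.sin a - Real.cos a * w)]

theorem integral_comp_cos_mul_sin {h : ℝ → ℝ} (hh : Continuous h) :
    ∫ a in (0 : ℝ)..Real.pi, h (Real.cos a) * Real.sin a = ∫ x in (-1 : ℝ)..1, h x := by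
  have := intervalIntegral.integral_comp_mul_deriv (a := 0) (b := Real.pi) (f := Real.cos)
    (f' := fun a => -Real.sin a) (g := h) (fun x _ => Real.hasDerivAt_cos x) (by fun_prop) hh
  simp only [Function.comp_apply, mul_neg, intervalIntegral.integral_neg, Real.cos_zero,
    Real.cos_pi] at this
  rw [intervalIntegral.integral_symm 1 (-1), ← this, neg_neg]

open Polynomial in
/-- The average over a circle of latitude solves the Legendre equation. -/
theorem exists_deriv_circle_integral {c p q : ℝ} (h : c ^ 2 + p ^ 2 + q ^ 2 = 1) (l : ℕ) :
    ∃ A₁ A₂ : ℝ → ℝ,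
      (∀ a, HasDerivAt (fun a => ∫ φ in (0 : ℝ)..2 * Real.pi,
        (legendreP l).eval (zcoord c p q a φ)) (A₁ a) a) ∧
      (∀ a, HasDerivAt A₁ (A₂ a) a) ∧
      ∀ a, Real.sin a * A₂ a + Real.cos a * A₁ a = -((l : ℝ) * (l + 1)) * (Real.sin a *
        ∫ φ in (0 : ℝ)..2 * Real.pi, (legendreP l).eval (zcoord c p q a φ)) := by
  set F := legendreP l with hF
  set w : ℝ → ℝ := fun φ => p * Real.cos φ + q * Real.sin φ with hw
  set w₁ : ℝ → ℝ := fun φ => -p * Real.sin φ + q * Real.cos φ with hw₁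
  set y : ℝ → ℝ → ℝ := fun a φ => -c * Real.sin a + Real.cos a * w φ with hy
  have hz : ∀ a φ, HasDerivAt (fun a => zcoord c p q a φ) (y a φ) a := fun a φ =>
    (((Real.hasDerivAt_cos a).const_mul c).add
      ((Real.hasDerivAt_sin a).mul_const (w φ))).congr_deriv (by simp only [hy]; ring)
  have hyd : ∀ a φ, HasDerivAt (fun a => y a φ) (-zcoord c p q a φ) a := fun a φ =>
    (((Real.hasDerivAt_sin a).const_mul (-c)).add
      ((Real.hasDerivAt_cos a).mul_const (w φ))).congr_deriv (by simp only [zcoord, hw]; ring)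
  have hwd : ∀ φ, HasDerivAt w (w₁ φ) φ := fun φ =>
    (((Real.hasDerivAt_cos φ).const_mul p).add
      ((Real.hasDerivAt_sin φ).const_mul q)).congr_deriv (by simp only [hw₁]; ring)
  have hwd₁ : ∀ φ, HasDerivAt w₁ (-w φ) φ := fun φ =>
    (((Real.hasDerivAt_sin φ).const_mul (-p)).add
      ((Real.hasDerivAt_cos φ).const_mul q)).congr_deriv (by simp only [hw]; ring)
  have hzφ : ∀ a φ, HasDerivAt (fun φ => zcoord c p q a φ) (Real.sin a * w₁ φ) φ := fun a φ =>
    (((hwd φ).const_mul (Real.sin a)).const_add (c * Real.cos a))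
  have cz := continuous_zcoord c p q
  have cy : Continuous fun x : ℝ × ℝ => y x.1 x.2 := by fun_prop
  have cza : ∀ a, Continuous fun φ => zcoord c p q a φ := fun a =>
    cz.comp (by fun_prop : Continuous fun φ => (a, φ))
  refine ⟨fun a => ∫ φ in (0 : ℝ)..2 * Real.pi,
      (derivative F).eval (zcoord c p q a φ) * y a φ,
    fun a => ∫ φ in (0 : ℝ)..2 * Real.pi,
      ((derivative (derivative F)).eval (zcoord c p q a φ) * y a φ * y a φ
        + (derivative F).eval (zcoord c p q a φ) * -zcoord c p q a φ), ?_, ?_, ?_⟩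
  · exact fun a => hasDerivAt_intervalIntegral_of_continuous
      (G := fun a φ => F.eval (zcoord c p q a φ))
      (G' := fun a φ => (derivative F).eval (zcoord c p q a φ) * y a φ) (by fun_prop) (by fun_prop)
      (fun a φ => (F.hasDerivAt _).comp a (hz a φ)) _ _ a
  · exact fun a => hasDerivAt_intervalIntegral_of_continuous
      (G := fun a φ => (derivative F).eval (zcoord c p q a φ) * y a φ)
      (G' := fun a φ => (derivative (derivative F)).eval (zcoord c p q a φ) * y a φ * y a φ
        + (derivative F).eval (zcoord c p q a φ) * -zcoord c p q a φ) (by fun_prop) (by fun_prop)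
      (fun a φ => (((derivative F).hasDerivAt _).comp a (hz a φ)).mul (hyd a φ)) _ _ a
  · intro a
    have cya : Continuous fun φ => y a φ := by fun_prop
    have cw₁ : Continuous w₁ := by fun_prop
    have cw : Continuous w := by fun_prop
    have hza := cza a
    -- The longitudinal part of the spherical Laplacian is a φ-derivative of a periodic function, so
    -- averaging over the circle removes it and leaves an equation in a alone.
    have key : ∫ φ in (0 : ℝ)..2 * Real.pi,
        ((derivative (derivative F)).eval (zcoord c p q a φ) * (Real.sin a * w₁ φ) * w₁ φ
          + (derivative F).eval (zcoord c p q a φ) * -w φ) = 0 := by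
      rw [intervalIntegral.integral_eq_sub_of_hasDerivAt
        (f := fun φ => (derivative F).eval (zcoord c p q a φ) * w₁ φ)]
      · simp [zcoord, hw₁]
      · intro φ _
        exact (((derivative F).hasDerivAt _).comp φ (hzφ a φ)).mul (hwd₁ φ)
      · exact (by fun_prop : Continuous _).intervalIntegrable _ _
    simp only [← intervalIntegral.integral_const_mul]
    rw [← sub_eq_zero, ← intervalIntegral.integral_add, ← intervalIntegral.integral_sub,
      ← neg_eq_zero, ← intervalIntegral.integral_neg, ← key]
    · congr 1
      ext φ
      have hL : (legendreOp F).eval (zcoord c p q a φ) =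
          -((l : ℝ) * (l + 1)) * F.eval (zcoord c p q a φ) := by
        rw [hF, legendreOp_legendreP, eval_mul, eval_C]
      rw [legendreOp_eval] at hL
      have h1 := Real.sin_sq_add_cos_sq a
      have h2 := Real.sin_sq_add_cos_sq φ
      have e1 : y a φ * y a φ + zcoord c p q a φ ^ 2 = 1 - w₁ φ * w₁ φ := by
        simp only [hy, hw, hw₁, zcoord]
        linear_combination (c ^ 2 + (p * Real.cos φ + q * Real.sin φ) ^ 2) * h1 + h
          + (p ^ 2 + q ^ 2) * h2
      have e2 : Real.sin a * zcoord c p q a φ + Real.cos a * y a φ = w φ := by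
        simp only [hy, hw, zcoord]
        linear_combination (p * Real.cos φ + q * Real.sin φ) * h1
      linear_combination (-Real.sin a * (derivative (derivative F)).eval (zcoord c p q a φ)) * e1
        - (derivative F).eval (zcoord c p q a φ) * e2 - Real.sin a * hL
    all_goals exact (by fun_prop : Continuous _).intervalIntegrable _ _

theorem continuous_circle_integral {g : ℝ → ℝ} (hg : Continuous g) (c p q : ℝ) :
    Continuous fun a => ∫ φ in (0 : ℝ)..2 * Real.pi, g (zcoord c p q a φ) :=
  intervalIntegral.continuous_parametric_intervalIntegral_of_continuous'
    (f := fun a φ => g (zcoord c p q a φ)) (hg.comp (continuous_zcoord c p q)) _ _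

open Polynomial in
theorem integral_circle_integral_mul_legendreP {c p q : ℝ} (h : c ^ 2 + p ^ 2 + q ^ 2 = 1)
    {k l : ℕ} (hkl : k ≠ l) :
    ∫ a in (0 : ℝ)..Real.pi, (∫ φ in (0 : ℝ)..2 * Real.pi, (legendreP l).eval (zcoord c p q a φ))
      * (legendreP k).eval (Real.cos a) * Real.sin a = 0 := by
  obtain ⟨A₁, A₂, h1, h2, h3⟩ := exists_deriv_circle_integral h l
  have cA := continuous_circle_integral (legendreP l).continuous c p q
  set A := fun a => ∫ φ in (0 : ℝ)..2 * Real.pi, (legendreP l).eval (zcoord c p q a φ) with hA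
  set K := legendreP k with hK
  have hp : ∀ a, HasDerivAt (fun a => K.eval (Real.cos a))
      ((derivative K).eval (Real.cos a) * -Real.sin a) a := fun a =>
    (K.hasDerivAt _).comp a (Real.hasDerivAt_cos a)
  have hp' : ∀ a, HasDerivAt (fun a => (derivative K).eval (Real.cos a))
      ((derivative (derivative K)).eval (Real.cos a) * -Real.sin a) a := fun a =>
    ((derivative K).hasDerivAt _).comp a (Real.hasDerivAt_cos a)
  have key : ∫ a in (0 : ℝ)..Real.pi, ((k : ℝ) * (k + 1) - l * (l + 1)) *
      (A a * K.eval (Real.cos a) * Real.sin a) = 0 := by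
    -- The Wronskian of A and P_k ∘ cos weighted by sin a; it vanishes at both poles.
    rw [intervalIntegral.integral_eq_sub_of_hasDerivAt (f := fun a => Real.sin a *
      (A₁ a * K.eval (Real.cos a) - A a * ((derivative K).eval (Real.cos a) * -Real.sin a)))]
    · simp
    · intro a _
      refine ((Real.hasDerivAt_sin a).mul (((h2 a).mul (hp a)).sub ((h1 a).mul ((hp' a).mul
        (Real.hasDerivAt_sin a).neg)))).congr_deriv ?_
      have hL : (legendreOp K).eval (Real.cos a) = -((k : ℝ) * (k + 1)) * K.eval (Real.cos a) := by
        rw [hK, legendreOp_legendreP, eval_mul, eval_C]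
      rw [legendreOp_eval] at hL
      have h4 := Real.sin_sq_add_cos_sq a
      simp only [Pi.mul_apply, Pi.sub_apply, Pi.neg_apply]
      linear_combination K.eval (Real.cos a) * h3 a - Real.sin a * A a * hL
        - Real.sin a * A a * (derivative (derivative K)).eval (Real.cos a) * h4
    · exact (by fun_prop : Continuous _).intervalIntegrable _ _
  rw [intervalIntegral.integral_const_mul] at key
  have hne : (k : ℝ) * (k + 1) ≠ l * (l + 1) := by
    norm_cast
    rcases hkl.lt_or_gt with h | h
    · exact (by nlinarith : k * (k + 1) < l * (l + 1)).ne
    · exact (by nlinarith : l * (l + 1) < k * (k + 1)).ne'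
  exact (mul_eq_zero.1 key).resolve_left (sub_ne_zero.2 hne)

/-- The product formula for Legendre polynomials. -/
theorem circle_integral_legendreP {c p q : ℝ} (h : c ^ 2 + p ^ 2 + q ^ 2 = 1) (l : ℕ) {a : ℝ}
    (ha : a ∈ Set.Icc 0 Real.pi) :
    ∫ φ in (0 : ℝ)..2 * Real.pi, (legendreP l).eval (zcoord c p q a φ) =
      2 * Real.pi * (legendreP l).eval c * (legendreP l).eval (Real.cos a) := by
  have cA := continuous_circle_integral (legendreP l).continuous c p q
  set A := fun a => ∫ φ in (0 : ℝ)..2 * Real.pi, (legendreP l).eval (zcoord c p q a φ) with hA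
  -- As a function of x = cos a the average is orthogonal to every P_k with k ≠ l, so by
  -- completeness it is a multiple of P_l. Its value at the pole a = 0 fixes the factor.
  set B := fun x => A (Real.arccos x) with hB
  have cB : Continuous B := cA.comp Real.continuous_arccos
  have hAB : ∀ a ∈ Set.Icc 0 Real.pi, A a = B (Real.cos a) := fun a ha => by
    simp only [hB, Real.arccos_cos ha.1 ha.2]
  have h0 : ∀ k, k ≠ l → ∫ x in (-1 : ℝ)..1, B x * (legendreP k).eval x = 0 := by
    intro k hk
    rw [← integral_comp_cos_mul_sin (h := fun x => B x * (legendreP k).eval x) (by fun_prop)]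
    refine Eq.trans ?_ (integral_circle_integral_mul_legendreP h hk)
    refine intervalIntegral.integral_congr fun a ha => ?_
    rw [Set.uIcc_of_le Real.pi_pos.le] at ha
    simp only [← hAB a ha, hA]
  set t := (2 * (l : ℝ) + 1) / 2 * ∫ x in (-1 : ℝ)..1, B x * (legendreP l).eval x with ht
  have h1 : ∀ x ∈ Set.Icc (-1 : ℝ) 1, B x - t * (legendreP l).eval x = 0 := by
    refine eq_zero_of_integral_mul_legendreP_eq_zero (by fun_prop) fun k => ?_
    simp only [sub_mul]
    rw [intervalIntegral.integral_sub ((by fun_prop : Continuous _).intervalIntegrable _ _)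
      ((by fun_prop : Continuous _).intervalIntegrable _ _)]
    simp only [mul_assoc, intervalIntegral.integral_const_mul]
    rcases eq_or_ne k l with rfl | hk
    · rw [integral_legendreP_sq, ht]
      have : (2 * (k : ℝ) + 1) ≠ 0 := by positivity
      field_simp; ring
    · rw [h0 k hk, integral_legendreP_mul_legendreP hk.symm, mul_zero, sub_zero]
  have h2 := h1 1 (by norm_num)
  rw [legendreP_eval_of_sq_eq_one l (by norm_num : (1 : ℝ) ^ 2 = 1)] at h2
  have h3 : B 1 = 2 * Real.pi * (legendreP l).eval c := by simp [hB, hA, zcoord]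
  have h4 := h1 (Real.cos a) ⟨Real.neg_one_le_cos a, Real.cos_le_one a⟩
  rw [← hAB a ha] at h4
  rw [← h3]
  simp only [one_pow, mul_one] at h2
  have : A a = B 1 * (legendreP l).eval (Real.cos a) := by
    rw [sub_eq_zero.1 h2, sub_eq_zero.1 h4]
  exact this

/-- At a maximizer x₀ of |P_l|, the product formula with c = cos a = x₀ writes P_l(x₀)² as an
average of values of P_l on [-1, 1]. So the maximum M satisfies M² ≤ M. -/
theorem abs_legendreP_le_one (l : ℕ) : ∀ x ∈ Set.Icc (-1 : ℝ) 1, |(legendreP l).eval x| ≤ 1 := by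
  obtain ⟨x₀, hx₀, hmax⟩ := (isCompact_Icc (a := (-1 : ℝ)) (b := 1)).exists_isMaxOn
    (f := fun x => |(legendreP l).eval x|) ⟨0, by norm_num⟩ (by fun_prop)
  set M := |(legendreP l).eval x₀| with hM
  have hM0 : 0 ≤ M := abs_nonneg _
  suffices M ≤ 1 from fun x hx => (hmax hx).trans this
  have h1 : x₀ ^ 2 + Real.sqrt (1 - x₀ ^ 2) ^ 2 + 0 ^ 2 = 1 := by
    rw [Real.sq_sqrt (by nlinarith [hx₀.1, hx₀.2])]; ring
  have h2 := circle_integral_legendreP h1 l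
    (a := Real.arccos x₀) ⟨Real.arccos_nonneg _, Real.arccos_le_pi _⟩
  rw [Real.cos_arccos hx₀.1 hx₀.2] at h2
  have h3 := intervalIntegral.norm_integral_le_of_norm_le_const (a := 0) (b := 2 * Real.pi) (C := M)
    (f := fun φ => (legendreP l).eval (zcoord x₀ (Real.sqrt (1 - x₀ ^ 2)) 0 (Real.arccos x₀) φ))
    (fun φ _ => hmax (zcoord_mem h1 _ φ))
  rw [h2, norm_mul, norm_mul, Real.norm_eq_abs, Real.norm_eq_abs, ← hM, sub_zero,
    abs_of_pos Real.two_pi_pos] at h3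
  have h4 : M * M ≤ M := by
    have := Real.two_pi_pos
    nlinarith
  by_contra hlt
  nlinarith

/-- The Funk–Hecke formula in polar coordinates. -/
theorem funk_hecke {c p q : ℝ} (h : c ^ 2 + p ^ 2 + q ^ 2 = 1) (k : ℕ) {g : ℝ → ℝ}
    (hg : Continuous g) :
    ∫ a in (0 : ℝ)..Real.pi, (legendreP k).eval (Real.cos a) * Real.sin a *
        ∫ φ in (0 : ℝ)..2 * Real.pi, g (zcoord c p q a φ) =
      2 * Real.pi * (∫ x in (-1 : ℝ)..1, g x * (legendreP k).eval x) * (legendreP k).eval c := by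
  -- D is the defect in the formula. It is linear, vanishes on each P_l by the product formula and
  -- is bounded in the sup norm, so it vanishes on all continuous functions by density of
  -- polynomials.
  set D : (ℝ → ℝ) → ℝ := fun g => (∫ a in (0 : ℝ)..Real.pi,
    (legendreP k).eval (Real.cos a) * Real.sin a *
      ∫ φ in (0 : ℝ)..2 * Real.pi, g (zcoord c p q a φ)) -
    2 * Real.pi * (∫ x in (-1 : ℝ)..1, g x * (legendreP k).eval x) * (legendreP k).eval c with hD
  have hsub : ∀ f g : ℝ → ℝ, Continuous f → Continuous g →
      D (fun x => f x - g x) = D f - D g := by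
    intro f g hf hg
    have cf := continuous_circle_integral hf c p q
    have cg := continuous_circle_integral hg c p q
    have e1 : ∀ a, ∫ φ in (0 : ℝ)..2 * Real.pi, (f (zcoord c p q a φ) - g (zcoord c p q a φ)) =
        (∫ φ in (0 : ℝ)..2 * Real.pi, f (zcoord c p q a φ)) -
        ∫ φ in (0 : ℝ)..2 * Real.pi, g (zcoord c p q a φ) := fun a => by
      have hz : Continuous fun φ => zcoord c p q a φ :=
        (continuous_zcoord c p q).comp (by fun_prop : Continuous fun φ => (a, φ))
      exact intervalIntegral.integral_sub ((hf.comp hz).intervalIntegrable _ _)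
        ((hg.comp hz).intervalIntegrable _ _)
    simp only [hD, e1, mul_sub, sub_mul]
    rw [intervalIntegral.integral_sub ((by fun_prop : Continuous _).intervalIntegrable _ _)
      ((by fun_prop : Continuous _).intervalIntegrable _ _), intervalIntegral.integral_sub
      ((by fun_prop : Continuous _).intervalIntegrable _ _)
      ((by fun_prop : Continuous _).intervalIntegrable _ _)]
    ring
  have hsmul : ∀ (r : ℝ) (f : ℝ → ℝ), D (fun x => r * f x) = r * D f := by
    intro r f
    simp only [hD, mul_assoc, intervalIntegral.integral_const_mul, mul_left_comm _ r]
    ring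
  have hleg : ∀ l, D (fun x => (legendreP l).eval x) = 0 := by
    intro l
    have e1 : ∫ a in (0 : ℝ)..Real.pi, (legendreP k).eval (Real.cos a) * Real.sin a *
        ∫ φ in (0 : ℝ)..2 * Real.pi, (legendreP l).eval (zcoord c p q a φ) =
        ∫ a in (0 : ℝ)..Real.pi, 2 * Real.pi * (legendreP l).eval c *
          ((legendreP l).eval (Real.cos a) * (legendreP k).eval (Real.cos a) * Real.sin a) := by
      refine intervalIntegral.integral_congr fun a ha => ?_
      rw [Set.uIcc_of_le Real.pi_pos.le] at ha
      simp only [circle_integral_legendreP h l ha]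
      ring
    simp only [hD, e1]
    rw [intervalIntegral.integral_const_mul, integral_comp_cos_mul_sin
      (h := fun x => (legendreP l).eval x * (legendreP k).eval x) (by fun_prop)]
    rcases eq_or_ne k l with rfl | hk
    · ring
    · rw [integral_legendreP_mul_legendreP hk.symm]; ring
  have hpoly : ∀ r : Polynomial ℝ, D (fun x => r.eval x) = 0 := by
    intro r
    have hm := mem_span_legendreP (r.natDegree + 1) r
      (Polynomial.degree_le_natDegree.trans_lt (by exact_mod_cast Nat.lt_succ_self _))
    generalize r.natDegree + 1 = n at hm
    induction hm using Submodule.span_induction with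
    | mem x hx => obtain ⟨l, -, rfl⟩ := hx; exact hleg l
    | zero => simp [hD]
    | add f g _ _ hf hg =>
      have := hsub (fun x => f.eval x) (fun x => (-1 : ℝ) * g.eval x) (by fun_prop) (by fun_prop)
      rw [hsmul (-1) (fun x => g.eval x), hf, hg] at this
      simpa using this
    | smul r f _ hf => simpa [hf] using hsmul r (fun x => f.eval x)
  have hbound : ∀ (ε : ℝ) (f : ℝ → ℝ), Continuous f → (∀ x ∈ Set.Icc (-1 : ℝ) 1, |f x| ≤ ε) →
      |D f| ≤ ε * (2 * Real.pi * Real.pi + 4 * Real.pi) := by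
    intro ε f hf hε
    have hε0 : 0 ≤ ε := (abs_nonneg _).trans (hε 0 (by norm_num))
    have b1 : ∀ a, |∫ φ in (0 : ℝ)..2 * Real.pi, f (zcoord c p q a φ)| ≤ ε * (2 * Real.pi) := by
      intro a
      have := intervalIntegral.norm_integral_le_of_norm_le_const (a := 0) (b := 2 * Real.pi)
        (C := ε) (f := fun φ => f (zcoord c p q a φ)) (fun φ _ => hε _ (zcoord_mem h a φ))
      rwa [sub_zero, abs_of_pos Real.two_pi_pos] at this
    have b2 := intervalIntegral.norm_integral_le_of_norm_le_const (a := 0) (b := Real.pi)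
      (C := ε * (2 * Real.pi)) (f := fun a => (legendreP k).eval (Real.cos a) * Real.sin a *
        ∫ φ in (0 : ℝ)..2 * Real.pi, f (zcoord c p q a φ)) (fun a _ => by
          rw [norm_mul, norm_mul, Real.norm_eq_abs, Real.norm_eq_abs, Real.norm_eq_abs]
          refine (mul_le_of_le_one_left (abs_nonneg _) ?_).trans (b1 a)
          exact mul_le_one₀ (abs_legendreP_le_one k _ ⟨Real.neg_one_le_cos a, Real.cos_le_one a⟩)
            (abs_nonneg _) (Real.abs_sin_le_one a))
    have b3 := intervalIntegral.norm_integral_le_of_norm_le_const (a := -1) (b := 1)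
      (C := ε) (f := fun x => f x * (legendreP k).eval x) (fun x hx => by
        rw [Set.uIoc_of_le (by norm_num)] at hx
        have hx' := Set.Ioc_subset_Icc_self hx
        rw [norm_mul]
        exact (mul_le_of_le_one_right (norm_nonneg _) (abs_legendreP_le_one k x hx')).trans
          (hε x hx'))
    have hc : c ∈ Set.Icc (-1 : ℝ) 1 := ⟨by nlinarith [sq_nonneg p, sq_nonneg q],
      by nlinarith [sq_nonneg p, sq_nonneg q]⟩
    rw [sub_zero, abs_of_pos Real.pi_pos, Real.norm_eq_abs] at b2
    rw [show |(1 : ℝ) - -1| = 2 by norm_num, Real.norm_eq_abs] at b3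
    refine (abs_sub _ _).trans ?_
    rw [abs_mul, abs_mul, abs_of_pos Real.two_pi_pos]
    have b4 : 2 * Real.pi * |∫ x in (-1 : ℝ)..1, f x * (legendreP k).eval x| *
        |(legendreP k).eval c| ≤ 2 * Real.pi * (ε * 2) :=
      (mul_le_of_le_one_right (by positivity) (abs_legendreP_le_one k c hc)).trans
        (mul_le_mul_of_nonneg_left b3 Real.two_pi_pos.le)
    linarith
  have : |D g| ≤ 0 := by
    refine le_of_forall_pos_le_add fun ε hε => ?_
    set K := 2 * Real.pi * Real.pi + 4 * Real.pi with hK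
    have hK0 : 0 < K := by positivity
    obtain ⟨r, hr⟩ := exists_polynomial_near_of_continuousOn (-1) 1 g hg.continuousOn (ε / K)
      (by positivity)
    have h1 := hbound (ε / K) (fun x => r.eval x - g x) (by fun_prop) fun x hx => (hr x hx).le
    rw [hsub _ _ r.continuous hg, hpoly, zero_sub, abs_neg, div_mul_cancel₀ _ hK0.ne'] at h1
    linarith
  exact sub_eq_zero.1 (abs_nonpos_iff.1 this)

/-! ### The bump function and the spectral weight at scale δ. -/

theorem hasDerivAt_max_zero_pow (n : ℕ) (x : ℝ) :
    HasDerivAt (fun x : ℝ => max x 0 ^ (n + 2)) ((n + 2) * max x 0 ^ (n + 1)) x := by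
  have hpow : HasDerivAt (fun x : ℝ => x ^ (n + 2)) ((n + 2) * x ^ (n + 1)) x := by
    simpa using hasDerivAt_pow (n + 2) x
  rcases lt_trichotomy x 0 with hx | rfl | hx
  · rw [max_eq_right hx.le, zero_pow (by omega), mul_zero]
    refine (hasDerivAt_const x (0 : ℝ)).congr_of_eventuallyEq ?_
    filter_upwards [gt_mem_nhds hx] with y hy
    rw [max_eq_right hy.le, zero_pow (by omega)]
  · rw [← hasDerivWithinAt_univ, ← Set.Iic_union_Ici (a := (0 : ℝ))]
    refine HasDerivWithinAt.union ?_ ?_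
    · rw [max_self, zero_pow (by omega), mul_zero]
      refine (hasDerivWithinAt_const (0 : ℝ) _ (0 : ℝ)).congr (fun y hy => ?_) (by simp)
      rw [max_eq_right (Set.mem_Iic.1 hy), zero_pow (by omega)]
    · rw [max_self]
      exact hpow.hasDerivWithinAt.congr (fun y hy => by rw [max_eq_left (Set.mem_Ici.1 hy)])
        (by simp)
  · rw [max_eq_left hx.le]
    refine hpow.congr_of_eventuallyEq ?_
    filter_upwards [lt_mem_nhds hx] with y hy
    rw [max_eq_left hy.le]

theorem integral_sq_le_of_eq_zero {f : ℝ → ℝ} (hf : Continuous f) {δ M : ℝ} (hδ : 0 < δ)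
    (h0 : ∀ x ∈ Set.Icc (-1) (1 - δ), f x = 0)
    (hM : ∀ x ∈ Set.Icc (1 - δ) 1, |f x| ≤ M) (hδ2 : δ ≤ 2) :
    ∫ x in (-1 : ℝ)..1, f x ^ 2 ≤ M ^ 2 * δ := by
  have ii : ∀ a b, IntervalIntegrable (fun x => f x ^ 2) volume a b := fun a b =>
    (hf.pow 2).intervalIntegrable a b
  rw [← intervalIntegral.integral_add_adjacent_intervals (ii (-1) (1 - δ)) (ii (1 - δ) 1)]
  have h1 : ∫ x in (-1 : ℝ)..(1 - δ), f x ^ 2 = 0 := by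
    rw [intervalIntegral.integral_congr (g := fun _ => 0) fun x hx => ?_]
    · simp
    · rw [Set.uIcc_of_le (by linarith)] at hx
      simp [h0 x hx]
  have h2 : ∫ x in (1 - δ)..1, f x ^ 2 ≤ ∫ x in (1 - δ)..1, M ^ 2 := by
    refine intervalIntegral.integral_mono_on (by linarith) (ii _ _) (by simp) fun x hx => ?_
    rw [← sq_abs]
    exact pow_le_pow_left₀ (abs_nonneg _) (hM x hx) 2
  rw [h1, zero_add]
  refine h2.trans (le_of_eq ?_)
  simp; ring

/-- A function of height one supported in the cap `1 - δ ≤ x`, with its Legendre coefficients. -/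
theorem exists_bump {δ : ℝ} (hδ : 0 < δ) (hδ2 : δ ≤ 2) :
    ∃ (b : ℕ → ℝ) (u : ℝ → ℝ),
      (∀ x ∈ Set.Icc (-1 : ℝ) 1, HasSum (fun l => b l * (legendreP l).eval x) (u x)) ∧
      u 1 = 1 ∧ (∀ x ≤ 1 - δ, u x = 0) ∧
      ∀ N : ℕ, ∑ l ∈ Finset.range N, 2 / (2 * (l : ℝ) + 1) * b l ^ 2 *
        (1 + δ ^ 2 * ((l : ℝ) * (l + 1)) ^ 2) ≤ 325 * δ := by
  set m : ℝ → ℝ := fun x => max ((x - (1 - δ)) / δ) 0 with hm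
  have hm0 : ∀ x ≤ 1 - δ, m x = 0 := fun x hx =>
    max_eq_right (div_nonpos_of_nonpos_of_nonneg (by linarith) hδ.le)
  have hm1 : ∀ x ≤ 1, m x ≤ 1 := fun x hx =>
    max_le ((div_le_one hδ).2 (by linarith)) zero_le_one
  have hmn : ∀ x, 0 ≤ m x := fun x => le_max_right _ _
  have cm : Continuous m := by fun_prop
  have hmd : ∀ (n : ℕ) x, HasDerivAt (fun x => m x ^ (n + 2)) ((n + 2) * m x ^ (n + 1) / δ) x := by
    intro n x
    have h1 : HasDerivAt (fun x : ℝ => (x - (1 - δ)) / δ) (1 / δ) x :=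
      ((hasDerivAt_id x).sub_const _).div_const _
    exact ((hasDerivAt_max_zero_pow n _).comp x h1).congr_deriv (by simp only [hm]; ring)
  have hu : ∀ x, HasDerivAt (fun x => m x ^ 3) (3 * m x ^ 2 / δ) x := fun x =>
    (hmd 1 x).congr_deriv (by norm_num)
  have hu' : ∀ x, HasDerivAt (fun x => 3 * m x ^ 2 / δ) (6 * m x / δ ^ 2) x := fun x =>
    (((hmd 0 x).const_mul 3).div_const δ).congr_deriv (by
      field_simp; norm_num)
  -- The cube makes u twice continuously differentiable across the edge of the cap, which the
  -- symmetry of the Legendre operator needs. Here v is the image of u under that operator.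
  set u : ℝ → ℝ := fun x => m x ^ 3 with hudef
  set v : ℝ → ℝ := fun x => (1 - x ^ 2) * (6 * m x / δ ^ 2) - 2 * x * (3 * m x ^ 2 / δ) with hv
  have cu : Continuous u := by fun_prop
  have cv : Continuous v := by fun_prop
  set I : ℕ → ℝ := fun l => ∫ y in (-1 : ℝ)..1, u y * (legendreP l).eval y with hI
  have hJ : ∀ l : ℕ, ∫ y in (-1 : ℝ)..1, v y * (legendreP l).eval y = -((l : ℝ) * (l + 1)) * I l := by
    intro l
    have h1 : ∫ y in (-1 : ℝ)..1, (legendreOp (legendreP l)).eval y * u y =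
        ∫ y in (-1 : ℝ)..1, (legendreP l).eval y * v y :=
      integral_legendreOp_mul (legendreP l) hu hu' (by fun_prop)
    simp only [hI, mul_comm (u _), mul_comm (v _)]
    rw [← h1, ← intervalIntegral.integral_const_mul]
    simp only [legendreOp_legendreP, Polynomial.eval_mul, Polynomial.eval_C, mul_assoc]
  have iu : ∫ x in (-1 : ℝ)..1, u x ^ 2 ≤ 1 ^ 2 * δ :=
    integral_sq_le_of_eq_zero cu hδ (fun x hx => by simp [hudef, hm0 x hx.2])
      (fun x hx => by
        rw [abs_of_nonneg (pow_nonneg (hmn x) 3)]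
        exact pow_le_one₀ (hmn x) (hm1 x hx.2)) hδ2
  -- On the cap 1 - x² ≤ 2δ offsets one power of δ in u'' ≤ 6/δ², giving 12/δ; the first-order term
  -- adds 6/δ.
  have iv : ∫ x in (-1 : ℝ)..1, v x ^ 2 ≤ (18 / δ) ^ 2 * δ := by
    refine integral_sq_le_of_eq_zero cv hδ (fun x hx => by simp [hv, hm0 x hx.2])
      (fun x hx => ?_) hδ2
    have hx1 : |x| ≤ 1 := abs_le.2 ⟨by linarith [hx.1], hx.2⟩
    have e1 : |1 - x ^ 2| ≤ 2 * δ := by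
      rw [abs_of_nonneg (by nlinarith [hx.1, hx.2])]
      nlinarith [hx.1, hx.2]
    have e2 : |6 * m x / δ ^ 2| ≤ 6 / δ ^ 2 := by
      rw [abs_of_nonneg (by have := hmn x; positivity)]
      gcongr
      linarith [hm1 x hx.2]
    have e3 : |3 * m x ^ 2 / δ| ≤ 3 / δ := by
      rw [abs_of_nonneg (by positivity)]
      gcongr
      linarith [pow_le_one₀ (n := 2) (hmn x) (hm1 x hx.2)]
    refine (abs_sub _ _).trans ?_
    rw [abs_mul, abs_mul]
    have e4 := mul_le_mul e1 e2 (abs_nonneg _) (by positivity)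
    have e5 : |2 * x| * |3 * m x ^ 2 / δ| ≤ 2 * (3 / δ) := by
      refine mul_le_mul ?_ e3 (abs_nonneg _) (by norm_num)
      rw [abs_mul, abs_two]; linarith
    have e6 : 2 * δ * (6 / δ ^ 2) + 2 * (3 / δ) = 18 / δ := by field_simp; norm_num
    linarith
  have hsum : Summable fun l : ℕ => |(2 * (l : ℝ) + 1) / 2 * I l| := by
    have cE : Continuous fun x => u x - v x := cu.sub cv
    have hE : ∀ l : ℕ, ∫ y in (-1 : ℝ)..1, (u y - v y) * (legendreP l).eval y =
        (1 + (l : ℝ) * (l + 1)) * I l := by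
      intro l
      simp only [sub_mul]
      rw [intervalIntegral.integral_sub ((by fun_prop : Continuous _).intervalIntegrable _ _)
        ((by fun_prop : Continuous _).intervalIntegrable _ _), hJ]
      simp only [hI]; ring
    have s1 : Summable fun l : ℕ => (2 * (l : ℝ) + 1) / 2 *
        (∫ y in (-1 : ℝ)..1, (u y - v y) * (legendreP l).eval y) ^ 2 :=
      summable_of_sum_le (fun l => by positivity) (sum_sq_integral_mul_legendreP_le cE)
    have s2 : Summable fun l : ℕ => 1 / ((l : ℝ) + 1) ^ 2 := by
      have := (summable_nat_add_iff 1).2 (Real.summable_one_div_nat_pow.2 one_lt_two)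
      simpa using this
    refine Summable.of_nonneg_of_le (fun l => abs_nonneg _) (fun l => ?_) (s1.add s2)
    rw [hE, abs_mul, abs_of_pos (by positivity : 0 < (2 * (l : ℝ) + 1) / 2)]
    -- The numbers r I_l are the Legendre integrals of u - v, square-summable with weight by Bessel.
    -- Splitting |I_l| = |r I_l| · (1/r) by the arithmetic–geometric mean inequality gives absolute
    -- summability.
    set r := 1 + (l : ℝ) * (l + 1) with hr
    have hr0 : 0 < r := by positivity
    have hl : (0 : ℝ) ≤ l := Nat.cast_nonneg l
    have e1 : (2 * (l : ℝ) + 1) / 2 / r ^ 2 ≤ 2 * (1 / ((l : ℝ) + 1) ^ 2) := by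
      rw [div_le_iff₀ (by positivity), mul_one_div, div_mul_eq_mul_div, le_div_iff₀ (by positivity)]
      have a1 : 2 * (l : ℝ) + 1 ≤ 2 * r := by nlinarith
      have a2 : ((l : ℝ) + 1) ^ 2 ≤ 2 * r := by nlinarith
      nlinarith [mul_le_mul a1 a2 (by positivity) (by positivity)]
    have e2 : |I l| ≤ (r * I l) ^ 2 / 2 + 1 / r ^ 2 / 2 := by
      have a1 : |I l| = |r * I l| * (1 / r) := by
        rw [abs_mul, abs_of_pos hr0]; field_simp
      rw [a1, ← sq_abs (r * I l), ← one_div_pow]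
      nlinarith [sq_nonneg (|r * I l| - 1 / r)]
    have e3 := mul_le_mul_of_nonneg_left e2 (by positivity : 0 ≤ (2 * (l : ℝ) + 1) / 2)
    have e4 : 0 ≤ (2 * (l : ℝ) + 1) / 2 * (r * I l) ^ 2 := by positivity
    have e5 : (2 * (l : ℝ) + 1) / 2 * (1 / r ^ 2 / 2) = (2 * (l : ℝ) + 1) / 2 / r ^ 2 / 2 := by
      ring
    rw [mul_add, e5] at e3
    linarith
  refine ⟨fun l => (2 * (l : ℝ) + 1) / 2 * I l, u,
    hasSum_legendre cu.continuousOn abs_legendreP_le_one hsum, ?_, ?_, ?_⟩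
  · simp [hudef, hm, hδ.ne']
  · intro x hx
    simp [hudef, hm0 x hx]
  -- Bessel for u contributes δ, and Bessel for v contributes δ² · 324/δ, for a total of 325 δ.
  · intro N
    have h1 := sum_sq_integral_mul_legendreP_le cu (Finset.range N)
    have h2 := sum_sq_integral_mul_legendreP_le cv (Finset.range N)
    have h3 : ∑ l ∈ Finset.range N, 2 / (2 * (l : ℝ) + 1) * ((2 * (l : ℝ) + 1) / 2 * I l) ^ 2 *
        (1 + δ ^ 2 * ((l : ℝ) * (l + 1)) ^ 2) =
        (∑ l ∈ Finset.range N, (2 * (l : ℝ) + 1) / 2 *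
          (∫ y in (-1 : ℝ)..1, u y * (legendreP l).eval y) ^ 2) +
        δ ^ 2 * ∑ l ∈ Finset.range N, (2 * (l : ℝ) + 1) / 2 *
          (∫ y in (-1 : ℝ)..1, v y * (legendreP l).eval y) ^ 2 := by
      rw [Finset.mul_sum, ← Finset.sum_add_distrib]
      refine Finset.sum_congr rfl fun l _ => ?_
      rw [hJ]
      have : (2 * (l : ℝ) + 1) ≠ 0 := by positivity
      field_simp
      ring
    rw [h3]
    have h4 := mul_le_mul_of_nonneg_left (h2.trans iv) (sq_nonneg δ)
    have h5 : δ ^ 2 * ((18 / δ) ^ 2 * δ) = 324 * δ := by field_simp; norm_num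
    linarith

theorem rpow_le_one_add_sq {t s : ℝ} (ht : 0 ≤ t) (hs : 0 ≤ s) (hs2 : s ≤ 2) :
    t ^ s ≤ 1 + t ^ 2 := by
  rcases le_total t 1 with h | h
  · linarith [Real.rpow_le_one ht h hs, sq_nonneg t]
  · have := Real.rpow_le_rpow_of_exponent_le h hs2
    rw [Real.rpow_two] at this
    linarith

/-- The lower bound on the angular power spectrum, at the scale `δ`. -/
theorem AssumptionI.exists_inv_le {α β : ℝ} {C : ℕ → ℝ → ℝ} (hI : AssumptionI α β C) :
    (∀ l, 0 < C l 0) ∧ ∃ K : ℝ, 0 < K ∧ ∀ (l : ℕ) (δ : ℝ), 0 < δ → δ ≤ 2 →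
      (C l 0)⁻¹ ≤ K * δ ^ (-(α / 2)) * (1 + δ ^ 2 * ((l : ℝ) * (l + 1)) ^ 2) := by
  obtain ⟨G, c₀, hc₀, hG⟩ := hI.decay
  have hα : 2 < α := by linarith [hI.lt_alpha, hI.beta_pos]
  have hα4 := hI.alpha_lt
  have hc0 : 0 < c₀ := by linarith
  have hz := hI.zero_pos
  have hlow : ∀ l : ℕ, 1 ≤ l → c₀⁻¹ * (l : ℝ) ^ (-α) ≤ C l 0 := fun l hl => by
    rw [(hG l hl).1]
    exact mul_le_mul_of_nonneg_right (hG l hl).2.1 (by positivity)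
  have hlowpos : ∀ l : ℕ, 1 ≤ l → 0 < c₀⁻¹ * (l : ℝ) ^ (-α) := fun l hl => by
    have : (0 : ℝ) < l := by exact_mod_cast hl
    positivity
  -- The summand c₀ serves l ≥ 1; the summand 4/C_0(0) serves l = 0, where δ^(α/2) ≤ 2^(α/2) ≤ 4.
  refine ⟨fun l => ?_, c₀ + 4 * (C 0 0)⁻¹, by positivity, fun l δ hδ hδ2 => ?_⟩
  · rcases Nat.eq_zero_or_pos l with rfl | hl
    · exact hz
    · exact (hlowpos l hl).trans_le (hlow l hl)
  · have hδα : δ ^ (-(α / 2)) * δ ^ (α / 2) = 1 := by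
      rw [← Real.rpow_add hδ]; simp
    have hp : 0 < δ ^ (-(α / 2)) := by positivity
    rcases Nat.eq_zero_or_pos l with rfl | hl
    · have h1 : δ ^ (α / 2) ≤ 4 := by
        have h2 := Real.rpow_le_rpow hδ.le hδ2 (by linarith : 0 ≤ α / 2)
        have h3 := Real.rpow_le_rpow_of_exponent_le one_le_two (by linarith : α / 2 ≤ 2)
        rw [Real.rpow_two] at h3
        linarith
      have h4 : 1 ≤ 4 * δ ^ (-(α / 2)) := by
        rw [← hδα, mul_comm 4]
        exact mul_le_mul_of_nonneg_left h1 hp.le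
      have hi : 0 < (C 0 0)⁻¹ := inv_pos.2 hz
      have h5 := mul_le_mul_of_nonneg_left h4 hi.le
      have h6 : 0 < c₀ * δ ^ (-(α / 2)) := by positivity
      simp only [CharP.cast_eq_zero, zero_add, zero_mul]
      nlinarith
    · have hl0 : (0 : ℝ) < l := by exact_mod_cast hl
      have h1 : (C l 0)⁻¹ ≤ c₀ * (l : ℝ) ^ α := by
        refine (inv_anti₀ (hlowpos l hl) (hlow l hl)).trans (le_of_eq ?_)
        rw [mul_inv, inv_inv, Real.rpow_neg hl0.le, inv_inv]
      -- Here α < 4 enters: (δ l²)^(α/2) ≤ 1 + (δ l²)², so one application of the Legendre operator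
      -- is enough.
      have h2 := rpow_le_one_add_sq (t := δ * l ^ 2) (s := α / 2) (by positivity) (by linarith)
        (by linarith)
      rw [Real.mul_rpow hδ.le (by positivity), ← Real.rpow_natCast (l : ℝ) 2,
        ← Real.rpow_mul hl0.le, Nat.cast_ofNat, mul_div_cancel₀ _ (two_ne_zero), Real.rpow_two] at h2
      have h3 : (l : ℝ) ^ α ≤ δ ^ (-(α / 2)) * (1 + (δ * l ^ 2) ^ 2) := by
        calc (l : ℝ) ^ α = δ ^ (-(α / 2)) * (δ ^ (α / 2) * (l : ℝ) ^ α) := by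
              rw [← mul_assoc, hδα, one_mul]
          _ ≤ _ := mul_le_mul_of_nonneg_left h2 hp.le
      have h4 : 1 + (δ * (l : ℝ) ^ 2) ^ 2 ≤ 1 + δ ^ 2 * ((l : ℝ) * (l + 1)) ^ 2 := by
        rw [mul_pow]
        gcongr
        nlinarith
      calc (C l 0)⁻¹ ≤ c₀ * (l : ℝ) ^ α := h1
        _ ≤ c₀ * (δ ^ (-(α / 2)) * (1 + δ ^ 2 * ((l : ℝ) * (l + 1)) ^ 2)) :=
            mul_le_mul_of_nonneg_left (h3.trans (mul_le_mul_of_nonneg_left h4 hp.le)) hc0.le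
        _ = c₀ * δ ^ (-(α / 2)) * (1 + δ ^ 2 * ((l : ℝ) * (l + 1)) ^ 2) := by ring
        _ ≤ _ := by
          gcongr
          linarith [inv_pos.2 hz]

/-! ### Polar frames and zonal coefficients of a Hilbert-valued field. -/

open scoped InnerProductSpace in
theorem exists_frame (x₀ : S2) : ∃ b : OrthonormalBasis (Fin 3) ℝ E3, b 2 = x₀ := by
  have hx : ‖(x₀ : E3)‖ = 1 := by simp
  obtain ⟨b, hb⟩ := Orthonormal.exists_orthonormalBasis_extension_of_card_eq (𝕜 := ℝ) (E := E3)
    (ι := Fin 3) (by simp) (v := fun _ => (x₀ : E3)) (s := {2}) (by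
      rw [orthonormal_iff_ite]
      rintro ⟨i, hi⟩ ⟨j, hj⟩
      simp only [Set.mem_singleton_iff] at hi hj
      subst hi hj
      simp [hx])
  exact ⟨b, hb 2 rfl⟩

/-- Polar coordinates on the sphere, with respect to an orthonormal frame. -/
noncomputable def polar (b : OrthonormalBasis (Fin 3) ℝ E3) (a φ : ℝ) : S2 :=
  ⟨b.repr.symm !₂[Real.sin a * Real.cos φ, Real.sin a * Real.sin φ, Real.cos a], by
    have h1 := Real.sin_sq_add_cos_sq a
    have h2 := Real.sin_sq_add_cos_sq φ
    have : Real.sqrt ((Real.sin a * Real.cos φ) ^ 2 + (Real.sin a * Real.sin φ) ^ 2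
        + Real.cos a ^ 2) = 1 := by
      rw [Real.sqrt_eq_one]
      linear_combination (Real.sin a ^ 2) * h2 + h1
    simpa [EuclideanSpace.norm_eq, Fin.sum_univ_three] using this⟩

theorem continuous_polar (b : OrthonormalBasis (Fin 3) ℝ E3) :
    Continuous fun x : ℝ × ℝ => polar b x.1 x.2 := by
  refine Continuous.subtype_mk (b.repr.symm.continuous.comp ?_) _
  refine (PiLp.continuous_toLp 2 _).comp (continuous_pi fun i => ?_)
  fin_cases i <;> simp <;> fun_prop

theorem inner_polar (b : OrthonormalBasis (Fin 3) ℝ E3) (a φ : ℝ) (y : E3) :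
    inner ℝ (polar b a φ : E3) y =
      zcoord (inner ℝ (b 2) y) (inner ℝ (b 0) y) (inner ℝ (b 1) y) a φ := by
  rw [← b.repr.inner_map_map, polar]
  simp only [LinearIsometryEquiv.apply_symm_apply, PiLp.inner_apply, Fin.sum_univ_three,
    b.repr_apply_apply, zcoord]
  simp
  ring

theorem sum_sq_inner_frame (b : OrthonormalBasis (Fin 3) ℝ E3) (y : S2) :
    (inner ℝ (b 2) (y : E3)) ^ 2 + (inner ℝ (b 0) (y : E3)) ^ 2 + (inner ℝ (b 1) (y : E3)) ^ 2
      = 1 := by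
  have := b.sum_sq_norm_inner_right (y : E3)
  simp [Fin.sum_univ_three] at this
  linarith

theorem inner_axis_polar (b : OrthonormalBasis (Fin 3) ℝ E3) (a φ : ℝ) :
    inner ℝ (b 2) (polar b a φ : E3) = Real.cos a := by
  rw [real_inner_comm, inner_polar]
  simp [zcoord, b.inner_eq_ite]

variable {H : Type*} [NormedAddCommGroup H] [InnerProductSpace ℝ H] [CompleteSpace H]

/-- The coefficient of the field at time `t₀` along the zonal harmonic of degree `k`. -/
noncomputable def zonalCoeff (Φ : S2 × ℝ → H) (b : OrthonormalBasis (Fin 3) ℝ E3) (t₀ : ℝ)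
    (k : ℕ) : H :=
  ∫ a in (0 : ℝ)..Real.pi, ((legendreP k).eval (Real.cos a) * Real.sin a) •
    ∫ φ in (0 : ℝ)..2 * Real.pi, Φ (polar b a φ, t₀)

theorem inner_zonalCoeff {Φ : S2 × ℝ → H} (hΦ : Continuous Φ)
    (b : OrthonormalBasis (Fin 3) ℝ E3) (t₀ : ℝ) (k : ℕ) (v : H) :
    inner ℝ v (zonalCoeff Φ b t₀ k) =
      ∫ a in (0 : ℝ)..Real.pi, (legendreP k).eval (Real.cos a) * Real.sin a *
        ∫ φ in (0 : ℝ)..2 * Real.pi, inner ℝ v (Φ (polar b a φ, t₀)) := by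
  have c1 : Continuous fun x : ℝ × ℝ => Φ (polar b x.1 x.2, t₀) :=
    hΦ.comp ((continuous_polar b).prodMk continuous_const)
  have c2 : Continuous fun a => ∫ φ in (0 : ℝ)..2 * Real.pi, Φ (polar b a φ, t₀) :=
    intervalIntegral.continuous_parametric_intervalIntegral_of_continuous'
      (f := fun a φ => Φ (polar b a φ, t₀)) c1 _ _
  have h1 := (innerSL ℝ v).intervalIntegral_comp_comm (a := 0) (b := Real.pi) (μ := volume)
    (f := fun a => ((legendreP k).eval (Real.cos a) * Real.sin a) •
      ∫ φ in (0 : ℝ)..2 * Real.pi, Φ (polar b a φ, t₀))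
    ((by fun_prop : Continuous _).intervalIntegrable _ _)
  simp only [innerSL_apply_apply] at h1
  rw [zonalCoeff, ← h1]
  congr 1
  ext a
  have c3 : Continuous fun φ => Φ (polar b a φ, t₀) := by
    have := (continuous_polar b).comp (by fun_prop : Continuous fun φ : ℝ => (a, φ))
    simp only [Function.comp_def] at this
    fun_prop
  have h2 := (innerSL ℝ v).intervalIntegral_comp_comm (a := 0) (b := 2 * Real.pi) (μ := volume)
    (f := fun φ => Φ (polar b a φ, t₀)) (c3.intervalIntegrable _ _)
  simp only [innerSL_apply_apply] at h2
  rw [inner_smul_right, h2]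

/-- Pairing with Φ(y, t) turns the defining integral into a zonal convolution of Γ with P_k, which
Funk–Hecke diagonalizes. -/
theorem inner_zonalCoeff_apply {Φ : S2 × ℝ → H} (hΦ : Continuous Φ) {Γ : ℝ → ℝ → ℝ}
    (hΓc : ∀ τ, Continuous fun η => Γ η τ)
    (hΓ : ∀ x t y s, inner ℝ (Φ (x, t)) (Φ (y, s)) = Γ (inner ℝ (x : E3) (y : E3)) (t - s))
    (b : OrthonormalBasis (Fin 3) ℝ E3) (t₀ : ℝ) (k : ℕ) (y : S2) (t : ℝ) :
    inner ℝ (Φ (y, t)) (zonalCoeff Φ b t₀ k) =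
      (2 * Real.pi * ∫ η in (-1 : ℝ)..1, Γ η (t₀ - t) * (legendreP k).eval η) *
        (legendreP k).eval (inner ℝ (b 2) (y : E3)) := by
  rw [inner_zonalCoeff hΦ]
  simp only [real_inner_comm (Φ (polar b _ _, t₀)), hΓ, inner_polar]
  exact funk_hecke (sum_sq_inner_frame b y) k (hΓc _)

/-- Both coefficients are taken about the same axis, so the inner circle integral has a constant
integrand and contributes 2π. Orthogonality of the V_k then reduces to that of the P_k. -/
theorem inner_zonalCoeff_zonalCoeff {Φ : S2 × ℝ → H} (hΦ : Continuous Φ) {Γ : ℝ → ℝ → ℝ}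
    (hΓc : ∀ τ, Continuous fun η => Γ η τ)
    (hΓ : ∀ x t y s, inner ℝ (Φ (x, t)) (Φ (y, s)) = Γ (inner ℝ (x : E3) (y : E3)) (t - s))
    (b : OrthonormalBasis (Fin 3) ℝ E3) (t₀ : ℝ) (j k : ℕ) :
    inner ℝ (zonalCoeff Φ b t₀ j) (zonalCoeff Φ b t₀ k) =
      2 * Real.pi * (2 * Real.pi * ∫ η in (-1 : ℝ)..1, Γ η 0 * (legendreP j).eval η) *
        ∫ x in (-1 : ℝ)..1, (legendreP j).eval x * (legendreP k).eval x := by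
  rw [inner_zonalCoeff hΦ]
  simp only [real_inner_comm (Φ (polar b _ _, t₀)), inner_zonalCoeff_apply hΦ hΓc hΓ,
    inner_axis_polar, sub_self, intervalIntegral.integral_const]
  generalize 2 * Real.pi * ∫ η in (-1 : ℝ)..1, Γ η 0 * (legendreP j).eval η = r
  rw [← integral_comp_cos_mul_sin (h := fun x => (legendreP j).eval x * (legendreP k).eval x)
    (by fun_prop), ← intervalIntegral.integral_const_mul]
  congr 1
  ext a
  simp
  ring

/-! ### The duality bound. -/

/-- The distance of the field at a point to the linear span of its values at points outside a cap
is bounded below. -/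
theorem one_le_mul_norm_sub_sum_sq_of_lt {Φ : S2 × ℝ → H} (hΦ : Continuous Φ) {Γ : ℝ → ℝ → ℝ}
    (hΓc : ∀ τ, Continuous fun η => Γ η τ)
    (hΓ : ∀ x t y s, inner ℝ (Φ (x, t)) (Φ (y, s)) = Γ (inner ℝ (x : E3) (y : E3)) (t - s))
    {C : ℕ → ℝ → ℝ}
    (hC : ∀ l τ, C l τ = 2 * Real.pi * ∫ η in (-1 : ℝ)..1, Γ η τ * (legendreP l).eval η)
    (hpos : ∀ l, 0 < C l 0) {h : ℝ → ℝ} (h0 : h 0 = 1)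
    (htime : ∀ l τ, |τ| < 1 → C l τ = C l 0 * h τ) {δ K : ℝ} (hδ : 0 < δ) (hδ2 : δ ≤ 2)
    (hK : ∀ l : ℕ, (C l 0)⁻¹ ≤ K * (1 + δ ^ 2 * ((l : ℝ) * (l + 1)) ^ 2))
    {n : ℕ} (x₀ : S2) (t₀ : ℝ) (x : Fin n → S2) (t : Fin n → ℝ) (ht : ∀ k, |t₀ - t k| < 1)
    (hx : ∀ k, inner ℝ (x₀ : E3) (x k : E3) ≤ 1 - δ) (a : Fin n → ℝ) :
    1 ≤ (2 * Real.pi * K * (325 * δ)) * ‖Φ (x₀, t₀) - ∑ k, a k • Φ (x k, t k)‖ ^ 2 := by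
  obtain ⟨b, hb⟩ := exists_frame x₀
  obtain ⟨c, u, hsum, hu1, hu0, hen⟩ := exists_bump hδ hδ2
  set V := zonalCoeff Φ b t₀ with hV
  set W : ℕ → H := fun N => ∑ l ∈ Finset.range N, (c l / C l 0) • V l with hW
  set X := Φ (x₀, t₀) - ∑ k, a k • Φ (x k, t k) with hX
  have hK0 : 0 ≤ K := by
    have := (inv_pos.2 (hpos 0)).trans_le (hK 0)
    simp at this
    exact this.le
  -- Dividing by C_l(0) leaves the temporal factor h, which does not depend on l and comes out of
  -- the sum.
  have hWΦ : ∀ N (y : S2) (s : ℝ), |t₀ - s| < 1 → inner ℝ (Φ (y, s)) (W N) =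
      h (t₀ - s) * ∑ l ∈ Finset.range N, c l * (legendreP l).eval (inner ℝ (x₀ : E3) (y : E3)) := by
    intro N y s hs
    simp only [hW, inner_sum, inner_smul_right, Finset.mul_sum]
    refine Finset.sum_congr rfl fun l _ => ?_
    rw [hV, inner_zonalCoeff_apply hΦ hΓc hΓ, ← hC, htime l _ hs, hb]
    have := (hpos l).ne'
    field_simp
  have hWlim : ∀ (y : S2) (s : ℝ), |t₀ - s| < 1 → Tendsto (fun N => inner ℝ (Φ (y, s)) (W N))
      atTop (𝓝 (h (t₀ - s) * u (inner ℝ (x₀ : E3) (y : E3)))) := by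
    intro y s hs
    simp only [hWΦ _ y s hs]
    refine Tendsto.const_mul _ (hsum _ ?_).tendsto_sum_nat
    rw [Set.mem_Icc, ← abs_le]
    simpa using abs_real_inner_le_norm (x₀ : E3) (y : E3)
  have hXlim : Tendsto (fun N => inner ℝ X (W N)) atTop (𝓝 1) := by
    have h1 : ∀ N, inner ℝ X (W N) = inner ℝ (Φ (x₀, t₀)) (W N) -
        ∑ k, a k * inner ℝ (Φ (x k, t k)) (W N) := by
      intro N
      simp [hX, inner_sub_left, sum_inner, inner_smul_left]
    simp only [h1]
    have h2 := (hWlim x₀ t₀ (by simp)).sub (tendsto_finsetSum Finset.univ fun k _ =>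
      (hWlim (x k) (t k) (ht k)).const_mul (a k))
    convert h2 using 2
    simp [hu0 _ (hx _), h0, hu1]
  -- By orthogonality ‖W N‖² is a diagonal sum; bounding C_l(0)⁻¹ by its weight turns it into the
  -- energy controlled by the bump.
  have hnorm : ∀ N, ‖W N‖ ^ 2 ≤ 2 * Real.pi * K * (325 * δ) := by
    intro N
    have h1 : ‖W N‖ ^ 2 = ∑ l ∈ Finset.range N,
        2 * Real.pi * (2 / (2 * (l : ℝ) + 1) * c l ^ 2 * (C l 0)⁻¹) := by
      rw [← real_inner_self_eq_norm_sq]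
      simp only [hW]
      rw [sum_inner]
      refine Finset.sum_congr rfl fun l hl => ?_
      rw [inner_sum, Finset.sum_eq_single l]
      · rw [inner_smul_left, inner_smul_right, hV, inner_zonalCoeff_zonalCoeff hΦ hΓc hΓ, ← hC,
          integral_legendreP_sq]
        have := (hpos l).ne'
        simp
        field_simp
      · intro k _ hk
        rw [inner_smul_left, inner_smul_right, hV, inner_zonalCoeff_zonalCoeff hΦ hΓc hΓ,
          integral_legendreP_mul_legendreP hk.symm]
        simp
      · exact fun h => absurd hl h
    calc ‖W N‖ ^ 2 ≤ ∑ l ∈ Finset.range N, 2 * Real.pi * K * (2 / (2 * (l : ℝ) + 1) * c l ^ 2 *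
          (1 + δ ^ 2 * ((l : ℝ) * (l + 1)) ^ 2)) := by
          rw [h1]
          refine Finset.sum_le_sum fun l _ => ?_
          have := mul_le_mul_of_nonneg_left (hK l)
            (by positivity : 0 ≤ 2 * Real.pi * (2 / (2 * (l : ℝ) + 1) * c l ^ 2))
          linarith
      _ ≤ _ := by
          rw [← Finset.mul_sum]
          exact mul_le_mul_of_nonneg_left (hen N) (by positivity)
  have h2 : ∀ N, inner ℝ X (W N) ^ 2 ≤ (2 * Real.pi * K * (325 * δ)) * ‖X‖ ^ 2 := by
    intro N
    calc inner ℝ X (W N) ^ 2 ≤ (‖X‖ * ‖W N‖) ^ 2 :=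
          sq_le_sq.2 ((abs_real_inner_le_norm X (W N)).trans (le_abs_self _))
      _ = ‖W N‖ ^ 2 * ‖X‖ ^ 2 := by ring
      _ ≤ _ := mul_le_mul_of_nonneg_right (hnorm N) (sq_nonneg _)
  have h3 := le_of_tendsto (hXlim.pow 2) (Eventually.of_forall h2)
  simpa using h3

/-- The factorization of C_l holds only for |τ| < 1. The endpoint |t₀ - t k| = 1 is reached by
contracting the times towards t₀ by a factor s < 1 and letting s → 1, as Φ is continuous and the
bound does not depend on s. -/
theorem one_le_mul_norm_sub_sum_sq {Φ : S2 × ℝ → H} (hΦ : Continuous Φ) {Γ : ℝ → ℝ → ℝ}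
    (hΓc : ∀ τ, Continuous fun η => Γ η τ)
    (hΓ : ∀ x t y s, inner ℝ (Φ (x, t)) (Φ (y, s)) = Γ (inner ℝ (x : E3) (y : E3)) (t - s))
    {C : ℕ → ℝ → ℝ}
    (hC : ∀ l τ, C l τ = 2 * Real.pi * ∫ η in (-1 : ℝ)..1, Γ η τ * (legendreP l).eval η)
    (hpos : ∀ l, 0 < C l 0) {h : ℝ → ℝ} (h0 : h 0 = 1)
    (htime : ∀ l τ, |τ| < 1 → C l τ = C l 0 * h τ) {δ K : ℝ} (hδ : 0 < δ) (hδ2 : δ ≤ 2)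
    (hK : ∀ l : ℕ, (C l 0)⁻¹ ≤ K * (1 + δ ^ 2 * ((l : ℝ) * (l + 1)) ^ 2))
    {n : ℕ} (x₀ : S2) (t₀ : ℝ) (x : Fin n → S2) (t : Fin n → ℝ) (ht : ∀ k, |t₀ - t k| ≤ 1)
    (hx : ∀ k, inner ℝ (x₀ : E3) (x k : E3) ≤ 1 - δ) (a : Fin n → ℝ) :
    1 ≤ (2 * Real.pi * K * (325 * δ)) * ‖Φ (x₀, t₀) - ∑ k, a k • Φ (x k, t k)‖ ^ 2 := by
  have hc : Continuous fun s : ℝ => (2 * Real.pi * K * (325 * δ)) *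
      ‖Φ (x₀, t₀) - ∑ k, a k • Φ (x k, t₀ + s * (t k - t₀))‖ ^ 2 := by fun_prop
  have h1 := (hc.tendsto 1).mono_left (nhdsWithin_le_nhds (s := Set.Iio 1))
  simp only [one_mul, add_sub_cancel] at h1
  refine ge_of_tendsto h1 ?_
  filter_upwards [Ioo_mem_nhdsLT (zero_lt_one' ℝ)] with s hs
  refine one_le_mul_norm_sub_sum_sq_of_lt hΦ hΓc hΓ hC hpos h0 htime hδ hδ2 hK x₀ t₀ x _
    (fun k => ?_) hx a
  have : t₀ - (t₀ + s * (t k - t₀)) = s * (t₀ - t k) := by ring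
  rw [this, abs_mul, abs_of_pos hs.1]
  exact (mul_le_of_le_one_right hs.1.le (ht k)).trans_lt hs.2

/-! ### Moving two points to the pole and the standard meridian. -/

theorem exists_adapted_frame (x y : S2) : ∃ b : OrthonormalBasis (Fin 3) ℝ E3, b 2 = x ∧
    (y : E3) = Real.sin (Real.arccos (inner ℝ (x : E3) (y : E3))) • b 0
      + inner ℝ (x : E3) (y : E3) • b 2 := by
  have hx : ‖(x : E3)‖ = 1 := by simp
  have hy : ‖(y : E3)‖ = 1 := by simp
  set c := inner ℝ (x : E3) (y : E3) with hc
  set v : E3 := y - c • (x : E3) with hv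
  have hxv : inner ℝ (x : E3) v = 0 := by
    rw [hv, inner_sub_right, inner_smul_right, real_inner_self_eq_norm_sq, hx]; simp [hc]
  have hvn : ‖v‖ = Real.sin (Real.arccos c) := by
    rw [Real.sin_arccos, ← Real.sqrt_sq (norm_nonneg v), hv, norm_sub_sq_real, norm_smul, hx, hy,
      inner_smul_right, real_inner_comm, ← hc]
    congr 1
    simp
    ring
  -- The degenerate case y = ±x leaves the first frame vector undetermined, and any frame with axis
  -- x works.
  by_cases h0 : v = 0
  · obtain ⟨b, hb⟩ := exists_frame x
    refine ⟨b, hb, ?_⟩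
    rw [← hvn, h0, hb, norm_zero, zero_smul, zero_add]
    exact sub_eq_zero.1 h0
  · have hv0 : ‖v‖ ≠ 0 := norm_ne_zero_iff.2 h0
    have hw : ‖‖v‖⁻¹ • v‖ = 1 := by rw [norm_smul, norm_inv, norm_norm, inv_mul_cancel₀ hv0]
    obtain ⟨b, hb⟩ := Orthonormal.exists_orthonormalBasis_extension_of_card_eq (𝕜 := ℝ) (E := E3)
      (ι := Fin 3) (by simp) (v := ![‖v‖⁻¹ • v, 0, (x : E3)]) (s := {0, 2}) (by
        constructor
        · rintro ⟨i, rfl | rfl⟩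
          · simpa using hw
          · simp [hx]
        · rintro ⟨i, rfl | rfl⟩ ⟨j, rfl | rfl⟩ hij
          · exact absurd rfl hij
          · simp [inner_smul_left, real_inner_comm, hxv]
          · simp [inner_smul_right, hxv]
          · exact absurd rfl hij)
    have hb0 : b 0 = ‖v‖⁻¹ • v := hb 0 (by simp)
    have hb2 : b 2 = (x : E3) := hb 2 (by simp)
    refine ⟨b, hb2, ?_⟩
    rw [← hvn, hb0, hb2, smul_inv_smul₀ hv0, hv]
    simp

theorem det_linearIsometryEquiv (g : E3 ≃ₗᵢ[ℝ] E3) :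
    LinearMap.det (g.toLinearEquiv : E3 →ₗ[ℝ] E3) = 1 ∨
      LinearMap.det (g.toLinearEquiv : E3 →ₗ[ℝ] E3) = -1 := by
  set e := EuclideanSpace.basisFun (Fin 3) ℝ
  have h1 := e.det_to_matrix_orthonormalBasis_real (e.map g)
  have h2 := e.toBasis.det_comp (g.toLinearEquiv : E3 →ₗ[ℝ] E3) e
  have h3 : e.toBasis.det e = 1 := by
    rw [← OrthonormalBasis.coe_toBasis]; exact e.toBasis.det_self
  rw [h3, mul_one] at h2
  rw [← h2]
  exact h1

/-- Two points of the sphere can be rotated to the north pole and to the standard meridian. -/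
theorem exists_rotation (x y : S2) : ∃ g : E3 ≃ₗᵢ[ℝ] E3,
    LinearMap.det (g.toLinearEquiv : E3 →ₗ[ℝ] E3) = 1 ∧ rot g x = meridian 0 ∧
      rot g y = meridian (Real.arccos (inner ℝ (x : E3) (y : E3))) := by
  obtain ⟨b, hb, hy⟩ := exists_adapted_frame x y
  have hcos : Real.cos (Real.arccos (inner ℝ (x : E3) (y : E3))) = inner ℝ (x : E3) (y : E3) :=
    have := abs_le.1 (show |inner ℝ (x : E3) (y : E3)| ≤ 1 by
      simpa using abs_real_inner_le_norm (x : E3) (y : E3))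
    Real.cos_arccos this.1 this.2
  have key : ∀ g : E3 ≃ₗᵢ[ℝ] E3, g (b 0) = EuclideanSpace.single 0 1 →
      g (b 2) = EuclideanSpace.single 2 1 → rot g x = meridian 0 ∧
      rot g y = meridian (Real.arccos (inner ℝ (x : E3) (y : E3))) := by
    intro g h0 h2
    constructor
    · apply Subtype.ext
      simp only [rot, meridian]
      rw [← hb, h2]
      ext i; fin_cases i <;> simp
    · apply Subtype.ext
      simp only [rot, meridian]
      rw [hcos]
      nth_rewrite 1 [hy]
      rw [map_add, map_smul, map_smul, h0, h2]
      ext i; fin_cases i <;> simp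
  rcases det_linearIsometryEquiv b.repr with h | h
  · exact ⟨b.repr, h, key _ (b.repr_self 0) (b.repr_self 2)⟩
  -- The meridian lies in the plane orthogonal to e, so reflecting in that plane corrects the
  -- determinant and fixes both images.
  · set e : E3 := EuclideanSpace.single 1 1 with he
    have he0 : e ≠ 0 := by simp [he]
    set R : E3 ≃ₗᵢ[ℝ] E3 := (ℝ ∙ e)ᗮ.reflection with hR
    have hdet : LinearMap.det (R.toLinearEquiv : E3 →ₗ[ℝ] E3) = -1 := by
      have := (ℝ ∙ e)ᗮ.det_reflection
      rw [Submodule.orthogonal_orthogonal, finrank_span_singleton he0, pow_one] at this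
      exact this
    refine ⟨b.repr.trans R, ?_, key _ ?_ ?_⟩
    · have : ((b.repr.trans R).toLinearEquiv : E3 →ₗ[ℝ] E3) =
          (R.toLinearEquiv : E3 →ₗ[ℝ] E3) ∘ₗ (b.repr.toLinearEquiv : E3 →ₗ[ℝ] E3) := rfl
      rw [this, LinearMap.det_comp, hdet, h]
      norm_num
    · rw [LinearIsometryEquiv.trans_apply, b.repr_self, hR]
      apply Submodule.reflection_mem_subspace_eq_self
      rw [Submodule.mem_orthogonal_singleton_iff_inner_right]
      simp [he, EuclideanSpace.inner_single_left]
    · rw [LinearIsometryEquiv.trans_apply, b.repr_self, hR]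
      apply Submodule.reflection_mem_subspace_eq_self
      rw [Submodule.mem_orthogonal_singleton_iff_inner_right]
      simp [he, EuclideanSpace.inner_single_left]

theorem continuous_meridian : Continuous meridian := by
  refine Continuous.subtype_mk ((PiLp.continuous_toLp 2 _).comp (continuous_pi fun i => ?_)) _
  fin_cases i <;> simp <;> fun_prop

/-! ### The field in L² and its conditional variance. -/

section Field

variable {Ω : Type*} [MeasurableSpace Ω] {μ : Measure Ω} {T : S2 × ℝ → Ω → ℝ}

theorem IsSpaceTimeField.measurable_apply (hT : IsSpaceTimeField μ T) (p : S2 × ℝ) :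
    Measurable (T p) :=
  hT.measurable.comp (measurable_const.prodMk measurable_id)

theorem IsSpaceTimeField.memLp_two (hT : IsSpaceTimeField μ T) (p : S2 × ℝ) : MemLp (T p) 2 μ :=
  (hT.gaussian.hasGaussianLaw_eval p).memLp_two

/-- The field as a map to `L²`. -/
noncomputable def IsSpaceTimeField.toL2 (hT : IsSpaceTimeField μ T) (p : S2 × ℝ) : Lp ℝ 2 μ :=
  (hT.memLp_two p).toLp (T p)

theorem inner_toLp_toLp {f g : Ω → ℝ} (hf : MemLp f 2 μ) (hg : MemLp g 2 μ) :
    inner ℝ (hf.toLp f) (hg.toLp g) = ∫ ω, f ω * g ω ∂μ := by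
  rw [L2.inner_def]
  refine integral_congr_ae ?_
  filter_upwards [hf.coeFn_toLp, hg.coeFn_toLp] with ω h1 h2
  rw [h1, h2]
  simp [mul_comm]

theorem IsSpaceTimeField.inner_toL2 (hT : IsSpaceTimeField μ T) (p q : S2 × ℝ) :
    inner ℝ (hT.toL2 p) (hT.toL2 q) = ∫ ω, T p ω * T q ω ∂μ :=
  inner_toLp_toLp _ _

theorem IsSpaceTimeField.continuous_toL2 (hT : IsSpaceTimeField μ T) : Continuous hT.toL2 := by
  refine continuous_iff_continuousAt.2 fun p => ?_
  rw [ContinuousAt, tendsto_iff_norm_sub_tendsto_zero]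
  have h1 : ∀ q, ‖hT.toL2 q - hT.toL2 p‖ ^ 2 = ∫ ω, (T q ω - T p ω) ^ 2 ∂μ := by
    intro q
    rw [← real_inner_self_eq_norm_sq, IsSpaceTimeField.toL2, IsSpaceTimeField.toL2,
      ← MemLp.toLp_sub, inner_toLp_toLp]
    congr 1
    ext ω
    simp [sq]
  have h2 := (hT.continuous p).sqrt
  simp only [← h1, Real.sqrt_sq (norm_nonneg _), Real.sqrt_zero] at h2
  exact h2

theorem IsSpaceTimeField.inner_toL2_eq_covFun (hT : IsSpaceTimeField μ T) (x : S2) (t : ℝ) (y : S2)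
    (s : ℝ) : inner ℝ (hT.toL2 (x, t)) (hT.toL2 (y, s)) =
      covFun μ T (inner ℝ (x : E3) (y : E3)) (t - s) := by
  obtain ⟨g, hg, h1, h2⟩ := exists_rotation x y
  -- The time shift -s brings the second point to time 0, where `covFun` is read off.
  have h := (hT.invariant g hg (-s) 2 ![(x, t), (y, s)]).comp
    (u := fun z : Fin 2 → ℝ => z 0 * z 1) (by fun_prop)
  have h3 := h.integral_eq
  simp only [Function.comp_def, Matrix.cons_val_zero, Matrix.cons_val_one, h1, h2] at h3
  rw [hT.inner_toL2, ← h3, covFun, neg_add_cancel, neg_add_eq_sub]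

/-- Continuity holds on all of ℝ, not only on [-1, 1], because `Real.arccos` is constant outside
that interval. -/
theorem IsSpaceTimeField.continuous_covFun (hT : IsSpaceTimeField μ T) (τ : ℝ) :
    Continuous fun η => covFun μ T η τ := by
  have h : (fun η => covFun μ T η τ) = fun η => inner ℝ (hT.toL2 (meridian 0, τ))
      (hT.toL2 (meridian (Real.arccos η), 0)) := by
    ext η; rw [hT.inner_toL2, covFun]
  rw [h]
  have := hT.continuous_toL2
  have := continuous_meridian
  have := Real.continuous_arccos
  fun_prop

theorem _root_.ProbabilityTheory.IsGaussianProcess.linear_combination {S R ι : Type*} [Fintype ι]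
    {X : R → Ω → ℝ} (hX : IsGaussianProcess X μ) (c : S → ι → ℝ) (τ : ι → R) :
    IsGaussianProcess (fun s ω => ∑ i, c s i * X (τ i) ω) μ := by
  classical
  exact hX.of_isGaussianProcess fun s => ⟨Finset.univ.image τ,
    ∑ i, c s i • ContinuousLinearMap.proj (R := ℝ) (φ := fun _ => ℝ)
      (⟨τ i, Finset.mem_image_of_mem τ (Finset.mem_univ i)⟩ : (Finset.univ.image τ : Finset R)),
    fun ω => by simp⟩

/-- The conditional variance of a Gaussian field is the squared distance in `L²` to a linear
combination of the conditioning values. -/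
theorem IsSpaceTimeField.exists_condVar_eq [IsProbabilityMeasure μ] (hT : IsSpaceTimeField μ T)
    {n : ℕ} (p₀ : S2 × ℝ) (p : Fin n → S2 × ℝ) : ∃ a : Fin n → ℝ,
      Var[T p₀; μ | sigmaAt T p] =ᵐ[μ]
        fun _ => ‖hT.toL2 p₀ - ∑ k, a k • hT.toL2 (p k)‖ ^ 2 := by
  classical
  set K := Submodule.span ℝ (Set.range fun k => hT.toL2 (p k)) with hK
  have : FiniteDimensional ℝ K := FiniteDimensional.span_of_finite ℝ (Set.finite_range _)
  obtain ⟨a, ha⟩ := (Submodule.mem_span_range_iff_exists_fun ℝ).1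
    (Submodule.coe_mem (K.orthogonalProjectionOnto (hT.toL2 p₀)))
  have horth : ∀ j, inner ℝ (hT.toL2 p₀ - ∑ k, a k • hT.toL2 (p k)) (hT.toL2 (p j)) = 0 := by
    intro j
    rw [ha]
    exact Submodule.starProjection_inner_eq_zero _ _ (Submodule.subset_span ⟨j, rfl⟩)
  refine ⟨a, ?_⟩
  set S : Ω → ℝ := fun ω => ∑ k, a k * T (p k) ω with hS
  set R : Ω → ℝ := fun ω => T p₀ ω - S ω with hR
  have mS : MemLp S 2 μ := memLp_finsetSum _ fun k _ => (hT.memLp_two (p k)).const_mul (a k)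
  have mR : MemLp R 2 μ := (hT.memLp_two p₀).sub mS
  have hRL : mR.toLp R = hT.toL2 p₀ - ∑ k, a k • hT.toL2 (p k) := by
    have h1 : mS.toLp S = ∑ k, a k • hT.toL2 (p k) := by
      apply Lp.ext
      have h2 : ∀ᵐ ω ∂μ, ∀ k, hT.toL2 (p k) ω = T (p k) ω :=
        ae_all_iff.2 fun k => (hT.memLp_two (p k)).coeFn_toLp
      have h3 : ∀ᵐ ω ∂μ, ∀ k, (a k • hT.toL2 (p k)) ω = a k * hT.toL2 (p k) ω :=
        ae_all_iff.2 fun k => Lp.coeFn_smul _ _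
      filter_upwards [mS.coeFn_toLp, h2, h3,
        Lp.coeFn_finsetSum Finset.univ fun k => a k • hT.toL2 (p k)] with ω h4 h5 h6 h7
      rw [h4, h7, Finset.sum_apply]
      simp [hS, h5, h6]
    rw [← h1]
    exact MemLp.toLp_sub _ _
  have hnorm : ‖hT.toL2 p₀ - ∑ k, a k • hT.toL2 (p k)‖ ^ 2 = ∫ ω, R ω ^ 2 ∂μ := by
    rw [← hRL, ← real_inner_self_eq_norm_sq, inner_toLp_toLp]
    simp only [sq]
  have hTi : ∀ q, Integrable (T q) μ := fun q => (hT.memLp_two q).integrable one_le_two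
  have iS : Integrable S μ := mS.integrable one_le_two
  have iR : Integrable R μ := mR.integrable one_le_two
  have hR0 : ∫ ω, R ω ∂μ = 0 := by
    rw [integral_sub (hTi _) iS, hT.centered, hS, integral_finsetSum _ fun k _ =>
      (hTi _).const_mul _]
    simp [integral_const_mul, hT.centered]
  have measS : Measurable S :=
    Finset.measurable_sum _ fun k _ => (hT.measurable_apply (p k)).const_mul _
  have measR : Measurable R := (hT.measurable_apply p₀).sub measS
  have hle : sigmaAt T p ≤ (inferInstance : MeasurableSpace Ω) :=
    iSup_le fun k => (hT.measurable_apply (p k)).comap_le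
  -- The residual R and the conditioning values are jointly Gaussian, being linear in `T p₀` and the
  -- `T (p k)`. Orthogonality and centering make R uncorrelated with these values, hence independent
  -- of them.
  have hjoint : IsGaussianProcess (Sum.elim (fun _ : Unit => R) fun k => T (p k)) μ := by
    have := hT.gaussian.linear_combination (S := Unit ⊕ Fin n) (ι := Option (Fin n))
      (Sum.elim (fun _ i => i.elim 1 fun k => -a k) fun j i => i.elim 0 fun k => if k = j then 1 else 0)
      (fun i => i.elim p₀ p)
    convert this using 1
    ext s ω
    rcases s with s | j
    · simp [hR, hS, Fintype.sum_option, Finset.sum_neg_distrib, sub_eq_add_neg]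
    · simp [Fintype.sum_option]
  have hind := hjoint.indepFun_of_covariance_eq_zero (fun _ => measR.aemeasurable)
    (fun k => (hT.measurable_apply (p k)).aemeasurable) (fun _ j => by
      rw [covariance_eq_sub mR (hT.memLp_two (p j)), hR0, zero_mul, sub_zero]
      have := horth j
      rw [← hRL, IsSpaceTimeField.toL2, inner_toLp_toLp] at this
      exact this)
  have hsig : sigmaAt T p = MeasurableSpace.comap (fun ω k => T (p k) ω) MeasurableSpace.pi := by
    rw [MeasurableSpace.pi, MeasurableSpace.comap_iSup]
    simp only [MeasurableSpace.comap_comp, Function.comp_def]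
  have hindR : Indep (MeasurableSpace.comap R inferInstance) (sigmaAt T p) μ := by
    rw [hsig]
    refine indep_of_indep_of_le_left hind ?_
    have : R = (fun f : Unit → ℝ => f ()) ∘ fun ω (_ : Unit) => R ω := rfl
    nth_rewrite 1 [this]
    rw [← MeasurableSpace.comap_comp]
    exact MeasurableSpace.comap_mono (measurable_pi_apply ()).comap_le
  have smS : StronglyMeasurable[sigmaAt T p] S := by
    refine Measurable.stronglyMeasurable (Finset.measurable_sum _ fun k _ => ?_)
    exact ((comap_measurable (T (p k))).mono (le_iSup (fun k =>
      MeasurableSpace.comap (T (p k)) inferInstance) k) le_rfl).const_mul (a k)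
  have hce : μ[T p₀|sigmaAt T p] =ᵐ[μ] S := by
    have h1 : T p₀ = R + S := by ext ω; simp [hR]
    have h2 := condExp_add iR iS (sigmaAt T p)
    have h3 := condExp_indep_eq measR.comap_le hle
      (comap_measurable R).stronglyMeasurable hindR
    rw [condExp_of_stronglyMeasurable hle smS iS, ← h1] at h2
    filter_upwards [h2, h3] with ω h4 h5
    rw [h4, Pi.add_apply, h5, hR0, zero_add]
  -- Since S is the conditional mean, the conditional variance is that of R, and independence makes
  -- it the constant E[R²].
  have h4 : Var[T p₀; μ | sigmaAt T p] =ᵐ[μ] μ[fun ω => R ω ^ 2|sigmaAt T p] := by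
    refine condExp_congr_ae ?_
    filter_upwards [hce] with ω h
    simp [hR, h]
  have h5 := condExp_indep_eq measR.comap_le hle
    (f := fun ω => R ω ^ 2) ((comap_measurable R).pow_const 2).stronglyMeasurable hindR
  rw [hnorm]
  exact h4.trans h5

end Field

/-! ### From cap height to geodesic distance, and the conclusion. -/

theorem mul_rho_sq_le_one_sub_cos_rpow {α r : ℝ} (hα : 2 < α) (hr : 0 < r) (hr' : r ≤ Real.pi) :
    (2 / Real.pi ^ 2) ^ ((α - 2) / 2) * rho α r ^ 2 ≤ (1 - Real.cos r) ^ ((α - 2) / 2) := by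
  have h1 := Real.cos_le_one_sub_mul_cos_sq (x := r) (by rwa [abs_of_pos hr])
  have h2 : rho α r ^ 2 = (r ^ 2) ^ ((α - 2) / 2) := by
    rw [rho, ← Real.rpow_natCast, ← Real.rpow_natCast, ← Real.rpow_mul hr.le,
      ← Real.rpow_mul hr.le, mul_comm]
  rw [h2, ← Real.mul_rpow (by positivity) (by positivity)]
  exact Real.rpow_le_rpow (by positivity) (by linarith) (by linarith)

end SphereTime

theorem mainTheorem3 {Ω : Type*} [MeasurableSpace Ω] (μ : Measure Ω) [IsProbabilityMeasure μ]
    (T : SphereTime.S2 × ℝ → Ω → ℝ) (hT : SphereTime.IsSpaceTimeField μ T)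
    (α β : ℝ) (hI : SphereTime.AssumptionI α β (SphereTime.powerSpectrum μ T)) :
    ∃ C : ℝ, 0 < C ∧
      ∀ (n : ℕ), 1 ≤ n → ∀ (p₀ : SphereTime.S2 × ℝ) (p : Fin n → SphereTime.S2 × ℝ),
        (∀ k, |p₀.2 - (p k).2| ≤ 1) →
        ∀ᵐ ω ∂μ,
          C * (⨅ k, SphereTime.rho α (SphereTime.dS2 p₀.1 (p k).1) ^ 2) ≤
            Var[T p₀; μ | SphereTime.sigmaAt T p] ω := by
  open SphereTime in
  obtain ⟨hpos, K, hK0, hK⟩ := hI.exists_inv_le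
  have hα : 2 < α := by linarith [hI.lt_alpha, hI.beta_pos]
  set s := (α - 2) / 2 with hs
  have hs0 : 0 < s := by rw [hs]; linarith
  -- The numerator comes from 1 - cos r ≥ (2/π²) r² on [0, π]; the denominator is the norm bound for
  -- W with its powers of δ removed.
  refine ⟨(2 / Real.pi ^ 2) ^ s / (2 * Real.pi * K * 325), by positivity, ?_⟩
  intro n hn p₀ p ht
  have : Nonempty (Fin n) := ⟨⟨0, hn⟩⟩
  obtain ⟨a, ha⟩ := hT.exists_condVar_eq p₀ p
  filter_upwards [ha] with ω hω
  rw [hω]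
  obtain ⟨k₀, hk₀⟩ := Finite.exists_min fun k => dS2 p₀.1 (p k).1
  set r := dS2 p₀.1 (p k₀).1 with hr
  have hinf : (⨅ k, rho α (dS2 p₀.1 (p k).1) ^ 2) ≤ rho α r ^ 2 :=
    ciInf_le (Set.finite_range _).bddBelow k₀
  refine (mul_le_mul_of_nonneg_left hinf (by positivity)).trans ?_
  have hr0 : 0 ≤ r := InnerProductGeometry.angle_nonneg _ _
  have hrpi : r ≤ Real.pi := InnerProductGeometry.angle_le_pi _ _
  -- If a conditioning site coincides with x₀ there is no cap, but ρ_α(0) = 0 since its exponent is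
  -- positive, so the bound is trivial.
  rcases hr0.eq_or_lt with h0 | h0
  · rw [← h0, rho, Real.zero_rpow hs0.ne']
    simp only [ne_eq, OfNat.ofNat_ne_zero, not_false_eq_true, zero_pow, mul_zero]
    positivity
  set δ := 1 - Real.cos r with hδdef
  have hδ : 0 < δ := by
    have := Real.cos_lt_cos_of_nonneg_of_le_pi le_rfl hrpi h0
    rw [Real.cos_zero] at this
    linarith
  have hδ2 : δ ≤ 2 := by linarith [Real.neg_one_le_cos r]
  have hmain := one_le_mul_norm_sub_sum_sq hT.continuous_toL2 hT.continuous_covFun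
    hT.inner_toL2_eq_covFun (C := powerSpectrum μ T) (fun l τ => rfl) hpos
    (h := fun τ => 1 - |τ| ^ β) (by simp [Real.zero_rpow hI.beta_pos.ne']) hI.time hδ hδ2
    (K := K * δ ^ (-(α / 2))) (fun l => hK l δ hδ hδ2) p₀.1 p₀.2 (fun k => (p k).1)
    (fun k => (p k).2) ht (fun k => ?_) a
  · have h1 := mul_rho_sq_le_one_sub_cos_rpow hα h0 hrpi
    -- The exponents balance: (α - 2)/2 - α/2 + 1 = 0.
    have h2 : δ ^ s * (δ ^ (-(α / 2)) * δ) = 1 := by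
      nth_rewrite 3 [← Real.rpow_one δ]
      rw [← Real.rpow_add hδ, ← Real.rpow_add hδ, hs]
      ring_nf
      simp
    rw [div_mul_eq_mul_div, div_le_iff₀ (by positivity)]
    refine h1.trans ?_
    have h3 := mul_le_mul_of_nonneg_left hmain (Real.rpow_nonneg hδ.le s)
    simp only [Prod.mk.eta] at h3
    calc (1 - Real.cos r) ^ ((α - 2) / 2) = δ ^ s * 1 := (mul_one _).symm
      _ ≤ _ := h3
      _ = (δ ^ s * (δ ^ (-(α / 2)) * δ)) * (‖hT.toL2 p₀ - ∑ k, a k • hT.toL2 (p k)‖ ^ 2 *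
          (2 * Real.pi * K * 325)) := by ring
      _ = _ := by rw [h2, one_mul]
  -- Cosine decreases on [0, π], so the nearest site has the largest inner product with x₀ and all
  -- sites satisfy ⟨x₀, x k⟩ ≤ 1 - δ.
  · have h1 : inner ℝ (p₀.1 : E3) ((p k).1 : E3) = Real.cos (dS2 p₀.1 (p k).1) := by
      rw [dS2, InnerProductGeometry.cos_angle]; simp
    rw [h1, hδdef, sub_sub_cancel]
    exact Real.cos_le_cos_of_nonneg_of_le_pi hr0 (InnerProductGeometry.angle_le_pi _ _) (hk₀ k)
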